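/- Let $W$ be a finite-dimensional complex vector space, let $V=W\oplus W^*$ carry the symplectic form $\langle (w_1,f_1),(w_2,f_2)\rangle=f_1(w_2)-f_2(w_1)$, and let $k\ge 1$ be an integer. Let $\mathcal L=\mathcal L(V)$ be the complex manifold of $k$-jets at $0$ of Lagrangian submanifolds of $V$ passing through $0$ (two germs are identified if they are tangent at $0$ to order $\ge k$, i.e. if, after a change of parameters, their parametrizations agree up to terms of order $k+1$), with the charts inverse to the maps $F\mapsto g(\text{graph of } dF)$, where $F$ is a polynomial on $W$ with terms in degrees $2,\dots,k+1$ only and $g\in Sp(V)$. Let $G=LG(V)$ be the Lagrangian Grassmannian, with the charts inverse to $Q\mapsto g(\text{graph of } dQ)$ for quadratic forms $Q$ on $W$ and $g\in Sp(V)$, and let $R$ be the tautological bundle on $G$, whose fibre at $L$ is $L$. Then the map $G\to\mathcal L$ that sends a Lagrangian subspace to its $k$-jet is a holomorphic embedding, and there is a natural isomorphism of holomorphic vector bundles on $G$ $$N_G\mathcal L=T\mathcal L|_G/TG\;\cong\;\bigoplus_{i=3}^{k+1}\mathrm{Sym}^i(R^*).$$ Precisely, there is a unique isomorphism $\Phi$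 of holomorphic vector bundles with the following property: for every $L\in G$, every splitting $V=L\oplus L'$ with $L'$ Lagrangian (so $L'\cong L^*$ through the symplectic form), and every $F\in\bigoplus_{i=3}^{k+1}\mathrm{Sym}^i(L^*)$, viewed as a polynomial on $L$, $\Phi_L$ sends to $F$ the class in the normal space at $L$ of the velocity at $t=0$ of the curve $t\mapsto k\text{-jet of the graph of } t\,dF:L\to L^*\cong L'$ in $\mathcal L$. In particular $\Phi$ does not depend on the choice of splittings. -/

import Mathlib

open scoped ContDiff Manifold Topology
open Filter Asymptotics

namespace LagrangianJets

noncomputable section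

section Analysis

variable {E E' : Type*} [NormedAddCommGroup E] [NormedSpace ℂ E]
  [NormedAddCommGroup E'] [NormedSpace ℂ E']

theorem norm_pow_isBigO_of_le {E : Type*} [NormedAddCommGroup E] {m n : ℕ} (hmn : n ≤ m) :
    (fun x : E => ‖x‖ ^ m) =O[𝓝 0] fun x => ‖x‖ ^ n := by
  refine IsBigO.of_bound 1 ?_
  have : ∀ᶠ x : E in 𝓝 0, ‖x‖ < 1 := by
    filter_upwards [Metric.ball_mem_nhds (0 : E) one_pos] with x hx
    simpa using hx
  filter_upwards [this] with x hx
  simpa using pow_le_pow_of_le_one (norm_nonneg x) hx.le hmn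

theorem exists_local_inverse [CompleteSpace E] {ψ : E → E'} {x₀ : E} (h : AnalyticAt ℂ ψ x₀)
    (hi : (fderiv ℂ ψ x₀).IsInvertible) :
    ∃ ρ : E' → E, AnalyticAt ℂ ρ (ψ x₀) ∧ ρ (ψ x₀) = x₀ ∧ (fderiv ℂ ρ (ψ x₀)).IsInvertible ∧
      (∀ᶠ y in 𝓝 (ψ x₀), ψ (ρ y) = y) ∧ (∀ᶠ x in 𝓝 x₀, ρ (ψ x) = x) := by
  obtain ⟨e, he⟩ := hi
  have hs : HasStrictFDerivAt ψ (e : E →L[ℂ] E') x₀ := he ▸ h.hasStrictFDerivAt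
  have hsrc : x₀ ∈ (hs.toOpenPartialHomeomorph ψ).source := hs.mem_toOpenPartialHomeomorph_source
  have han : AnalyticAt ℂ hs.localInverse (ψ x₀) :=
    (hs.toOpenPartialHomeomorph ψ).analyticAt_symm' hsrc h he.symm
  refine ⟨hs.localInverse, han, hs.localInverse_apply_image, ?_, hs.eventually_right_inverse,
    hs.eventually_left_inverse⟩
  rw [hs.to_localInverse.hasFDerivAt.fderiv]
  exact ContinuousLinearMap.isInvertible_equiv

variable [CompleteSpace E']

theorem isBigO_pow_of_iteratedFDeriv {h : E → E'} (hh : AnalyticAt ℂ h 0) {m : ℕ}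
    (h0 : ∀ i < m, iteratedFDeriv ℂ i h 0 = 0) : h =O[𝓝 0] fun x => ‖x‖ ^ m := by
  obtain ⟨p, r, hp⟩ := hh
  have key := HasFPowerSeriesAt.isBigO_sub_partialSum_pow ⟨r, hp⟩ m
  refine key.congr_left fun y => ?_
  have : p.partialSum m y = 0 := by
    refine Finset.sum_eq_zero fun i hi => ?_
    have h1 := hp.iteratedFDeriv_eq_sum_of_completeSpace (n := i) (fun _ => y)
    rw [h0 i (Finset.mem_range.1 hi)] at h1
    simp only [Finset.sum_const, zero_apply] at h1
    have h2 := h1.symm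
    rw [← Nat.cast_smul_eq_nsmul ℂ, smul_eq_zero] at h2
    rcases h2 with h2 | h2
    · exact absurd (Nat.cast_eq_zero.1 h2) (by simp [Fintype.card_perm, Nat.factorial_ne_zero])
    · exact h2
  rw [this]; simp

theorem iteratedFDeriv_eq_zero_of_isBigO {h : E → E'} (hh : AnalyticAt ℂ h 0) {m : ℕ}
    (h0 : h =O[𝓝 0] fun x => ‖x‖ ^ m) : ∀ i < m, iteratedFDeriv ℂ i h 0 = 0 := by
  obtain ⟨p, r, hp⟩ := hh
  have diag : ∀ i < m, ∀ y, p i (fun _ => y) = 0 := by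
    intro i
    induction i using Nat.strong_induction_on with
    | _ i ih =>
      intro him
      refine Asymptotics.IsBigO.continuousMultilinearMap_apply_eq_zero ?_
      have key := HasFPowerSeriesAt.isBigO_sub_partialSum_pow ⟨r, hp⟩ (i + 1)
      have h1 := (h0.trans (norm_pow_isBigO_of_le him)).sub key
      refine h1.congr_left fun y => ?_
      rw [FormalMultilinearSeries.partialSum, Finset.sum_range_succ, Finset.sum_eq_zero]
      · simp
      · intro j hj
        have := Finset.mem_range.1 hj
        exact ih j this (this.trans him) y
  intro i hi
  ext v
  rw [hp.iteratedFDeriv_eq_sum_of_completeSpace,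
    ← ContinuousMultilinearMap.iteratedFDeriv_comp_diagonal (p i) 0 v]
  have : (fun x => (p i) fun _ => x) = fun _ => (0 : E') := funext (diag i hi)
  rw [this]
  simp

end Analysis

section Forms

variable {M N : Type*} [NormedAddCommGroup M] [NormedSpace ℂ M]
  [NormedAddCommGroup N] [NormedSpace ℂ N]

/-- `Sym^i(M*)` for a complex vector space `M`: the symmetric `i`-linear forms on `M`. Such a form
`f` is identified with the homogeneous polynomial `x ↦ f (x, …, x)` of degree `i` on `M`. -/
def SymForm (i : ℕ) (M : Type*) [NormedAddCommGroup M] [NormedSpace ℂ M] :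
    Submodule ℂ (ContinuousMultilinearMap ℂ (fun _ : Fin i => M) ℂ) where
  carrier := {f | ∀ (σ : Equiv.Perm (Fin i)) (v : Fin i → M), f (fun j => v (σ j)) = f v}
  add_mem' hf hg σ v := by simp [hf σ v, hg σ v]
  zero_mem' σ v := by simp
  smul_mem' c f hf σ v := by simp [hf σ v]

/-- The direct sum `⨁_{i = a}^{b} Sym^i(M*)`. -/
abbrev SymSum (a b : ℕ) (M : Type*) [NormedAddCommGroup M] [NormedSpace ℂ M] : Type _ :=
  (i : Finset.Icc a b) → SymForm (i : ℕ) M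

/-- The polynomial function on `M` given by an element of `⨁_{i = a}^{b} Sym^i(M*)`. -/
def SymSum.eval {a b : ℕ} (F : SymSum a b M) (x : M) : ℂ :=
  ∑ i : Finset.Icc a b, (F i).1 (fun _ => x)

/-- Pull-back of symmetric forms along a linear map. -/
def SymForm.pullback {i : ℕ} (A : M →L[ℂ] N) (f : SymForm i N) : SymForm i M :=
  ⟨(f : ContinuousMultilinearMap ℂ (fun _ : Fin i => N) ℂ).compContinuousLinearMap fun _ => A,
    fun σ v => f.2 σ fun j => A (v j)⟩

/-- Pull-back of polynomials along a linear map. -/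
def SymSum.pullback {a b : ℕ} (A : M →L[ℂ] N) (F : SymSum a b N) : SymSum a b M :=
  fun i => SymForm.pullback A (F i)

/-- The Taylor coefficient of degree `i` of the polynomial. -/
def SymSum.coeff {a b : ℕ} (F : SymSum a b M) (i : ℕ) :
    ContinuousMultilinearMap ℂ (fun _ : Fin i => M) ℂ :=
  if h : i ∈ Finset.Icc a b then (F ⟨i, h⟩).1 else 0

theorem SymSum.hasFPowerSeries {a b : ℕ} (F : SymSum a b M) :
    HasFPowerSeriesOnBall F.eval (fun i => F.coeff i) 0 ⊤ where
  r_le := by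
    refine le_of_eq (Eq.symm ?_)
    refine FormalMultilinearSeries.radius_eq_top_of_forall_image_add_eq_zero _ (b + 1) fun n => ?_
    have : n + (b + 1) ∉ Finset.Icc a b := by simp; omega
    simp [SymSum.coeff, this]
  r_pos := by simp
  hasSum := by
    intro y _
    have h1 : ∀ i ∉ Finset.Icc a b, F.coeff i (fun _ => y) = 0 := by
      intro i hi
      simp [SymSum.coeff, hi]
    have h2 := hasSum_sum_of_ne_finset_zero (L := .unconditional ℕ) h1
    rw [zero_add]
    have h3 : F.eval y = ∑ i ∈ Finset.Icc a b, F.coeff i (fun _ => y) := by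
      rw [← Finset.sum_coe_sort (Finset.Icc a b)]
      refine Finset.sum_congr rfl fun i _ => ?_
      simp [SymSum.coeff]
    rw [h3]
    exact h2

theorem SymSum.contDiff {a b : ℕ} (F : SymSum a b M) : ContDiff ℂ ω F.eval := by
  unfold SymSum.eval
  refine ContDiff.sum fun i _ => ?_
  exact (ContinuousMultilinearMap.contDiff _).comp (contDiff_pi.2 fun _ => contDiff_id)

theorem SymSum.analyticAt {a b : ℕ} (F : SymSum a b M) (x : M) : AnalyticAt ℂ F.eval x :=
  F.contDiff.contDiffAt.analyticAt

theorem SymSum.iteratedFDeriv_eval {a b : ℕ} (F : SymSum a b M) (i : ℕ) (v : Fin i → M) :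
    iteratedFDeriv ℂ i F.eval 0 v = (i.factorial : ℂ) * F.coeff i v := by
  rw [F.hasFPowerSeries.iteratedFDeriv_eq_sum_of_completeSpace]
  have : ∀ σ : Equiv.Perm (Fin i), F.coeff i (fun j => v (σ j)) = F.coeff i v := by
    intro σ
    by_cases h : i ∈ Finset.Icc a b
    · simp only [SymSum.coeff, h, dif_pos]
      exact (F ⟨i, h⟩).2 σ v
    · simp [SymSum.coeff, h]
  simp [this, Fintype.card_perm]

theorem SymSum.fderiv_eval_zero {a b : ℕ} (ha : 2 ≤ a) (F : SymSum a b M) :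
    fderiv ℂ F.eval 0 = 0 := by
  ext v
  have h := F.iteratedFDeriv_eval 1 (fun _ => v)
  rw [iteratedFDeriv_one_apply] at h
  rw [h, SymSum.coeff, dif_neg (by simp; omega)]
  simp

theorem SymSum.ext_coeff {a b : ℕ} {F G : SymSum a b M} (h : ∀ i ∈ Finset.Icc a b,
    ∀ v, F.coeff i v = G.coeff i v) : F = G := by
  funext i
  ext v
  have := h i i.2 v
  simpa [SymSum.coeff] using this

/-- The Taylor polynomial is determined by the jet of its differential. -/
theorem SymSum.eq_of_isBigO {k : ℕ} {F G : SymSum 2 (k + 1) M}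
    (h : (fun x => fderiv ℂ F.eval x - fderiv ℂ G.eval x) =O[𝓝 0] fun x => ‖x‖ ^ (k + 1)) :
    F = G := by
  refine SymSum.ext_coeff fun i hi v => ?_
  obtain ⟨j, rfl⟩ : ∃ j, i = j + 1 := ⟨i - 1, by have := (Finset.mem_Icc.1 hi).1; omega⟩
  have hFG : (fun x => fderiv ℂ F.eval x - fderiv ℂ G.eval x) =
      fderiv ℂ (fun x => F.eval x - G.eval x) := by
    ext1 x
    rw [fderiv_fun_sub (F.analyticAt x).differentiableAt (G.analyticAt x).differentiableAt]
  have han : AnalyticAt ℂ (fun x => F.eval x - G.eval x) 0 := (F.analyticAt 0).sub (G.analyticAt 0)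
  rw [hFG] at h
  have h1 := iteratedFDeriv_eq_zero_of_isBigO han.fderiv h j
    (by have := (Finset.mem_Icc.1 hi).2; omega)
  have h2 : iteratedFDeriv ℂ (j + 1) (fun x => F.eval x - G.eval x) 0 v = 0 := by
    rw [iteratedFDeriv_succ_apply_right]
    change (iteratedFDeriv ℂ j (fderiv ℂ (fun x => F.eval x - G.eval x)) 0) _ _ = 0
    rw [h1]; simp
  have h3 : iteratedFDeriv ℂ (j + 1) (fun x => F.eval x - G.eval x) 0 v =
      iteratedFDeriv ℂ (j + 1) F.eval 0 v - iteratedFDeriv ℂ (j + 1) G.eval 0 v := by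
    have := iteratedFDeriv_sub_apply (i := j + 1) (𝕜 := ℂ) (x := (0 : M)) (f := F.eval)
      (g := G.eval) (F.contDiff.contDiffAt.of_le le_top) (G.contDiff.contDiffAt.of_le le_top)
    change iteratedFDeriv ℂ (j + 1) (F.eval - G.eval) 0 v = _
    rw [this]; simp
  rw [h2, F.iteratedFDeriv_eval, G.iteratedFDeriv_eval, ← mul_sub, zero_eq_mul] at h3
  rcases h3 with h3 | h3
  · exact absurd (Nat.cast_eq_zero.1 h3) (Nat.factorial_ne_zero _)
  · exact sub_eq_zero.1 h3

end Forms

section Symplectic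

variable {W : Type*} [NormedAddCommGroup W] [NormedSpace ℂ W]

/-- The symplectic vector space `V = W ⊕ W*`. -/
abbrev SympSpace (W : Type*) [NormedAddCommGroup W] [NormedSpace ℂ W] : Type _ :=
  W × StrongDual ℂ W

/-- The symplectic form `⟨(w₁, f₁), (w₂, f₂)⟩ = f₁(w₂) - f₂(w₁)` on `V = W ⊕ W*`. -/
def omega (u v : SympSpace W) : ℂ := u.2 v.1 - v.2 u.1

theorem omega_add_left (u u' v : SympSpace W) : omega (u + u') v = omega u v + omega u' v := by
  simp [omega]; ring

theorem omega_add_right (u v v' : SympSpace W) : omega u (v + v') = omega u v + omega u v' := by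
  simp [omega]; ring

theorem omega_smul_left (c : ℂ) (u v : SympSpace W) : omega (c • u) v = c * omega u v := by
  simp [omega]; ring

theorem omega_smul_right (c : ℂ) (u v : SympSpace W) : omega u (c • v) = c * omega u v := by
  simp [omega]; ring

theorem omega_swap (u v : SympSpace W) : omega u v = - omega v u := by
  simp [omega]

/-- The linear symplectic group `Sp(V)`. -/
def Sp (W : Type*) [NormedAddCommGroup W] [NormedSpace ℂ W] :
    Subgroup (SympSpace W ≃L[ℂ] SympSpace W) where
  carrier := {g | ∀ u v, omega (g u) (g v) = omega u v}
  mul_mem' hg hh u v := by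
    exact (hg _ _).trans (hh u v)
  one_mem' u v := rfl
  inv_mem' {g} hg u v := by
    rw [← hg]
    change omega (g (g.symm u)) (g (g.symm v)) = _
    simp

theorem eq_zero_of_omega {v : SympSpace W} (h : ∀ u, omega u v = 0) : v = 0 := by
  have h1 : v.2 = 0 := by
    ext w
    simpa [omega] using h (w, 0)
  have h2 : v.1 = 0 := by
    by_contra h3
    obtain ⟨f, -, hf⟩ := exists_dual_vector ℂ v.1 (norm_ne_zero_iff.2 h3)
    have := h (0, f)
    simp [omega, hf] at this
    exact h3 this
  exact Prod.ext h2 h1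

variable [FiniteDimensional ℂ W]

/-- A linear Lagrangian embedding of `W` extends to a linear symplectic automorphism of `V`. -/
theorem exists_frame (M : W →L[ℂ] SympSpace W) (hM : Function.Injective M)
    (hiso : ∀ u v, omega (M u) (M v) = 0) : ∃ g ∈ Sp W, ∀ w, g (w, 0) = M w := by
  -- the pairing with `M`
  let B : SympSpace W →ₗ[ℂ] StrongDual ℂ W :=
    { toFun := fun v => LinearMap.toContinuousLinearMap
        { toFun := fun w => omega v (M w)
          map_add' := fun x y => by rw [map_add, omega_add_right]
          map_smul' := fun c x => by rw [map_smul, omega_smul_right]; rfl }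
      map_add' := fun x y => by ext w; exact omega_add_left _ _ _
      map_smul' := fun c x => by ext w; exact omega_smul_left _ _ _ }
  have hB : ∀ v w, B v w = omega v (M w) := fun v w => rfl
  have hsurj : LinearMap.range B = ⊤ := by
    rw [LinearMap.range_eq_top]
    intro f
    obtain ⟨P, hP⟩ := (M : W →ₗ[ℂ] SympSpace W).exists_leftInverse_of_injective
      (LinearMap.ker_eq_bot.2 hM)
    have hP' : ∀ w, P (M w) = w := fun w => LinearMap.congr_fun hP w
    let φ : SympSpace W →ₗ[ℂ] ℂ := (f : W →ₗ[ℂ] ℂ) ∘ₗ P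
    -- represent `φ` by the symplectic form
    let p : StrongDual ℂ W := LinearMap.toContinuousLinearMap (φ ∘ₗ LinearMap.inl ℂ _ _)
    let ξ : StrongDual ℂ W →ₗ[ℂ] ℂ := φ ∘ₗ LinearMap.inr ℂ _ _
    obtain ⟨q, hq⟩ : ∃ q : W, ∀ f : StrongDual ℂ W, f q = ξ f := by
      let ξ' : Module.Dual ℂ (Module.Dual ℂ W) :=
        ξ ∘ₗ (LinearMap.toContinuousLinearMap : (W →ₗ[ℂ] ℂ) ≃ₗ[ℂ] (W →L[ℂ] ℂ)).toLinearMap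
      refine ⟨(Module.evalEquiv ℂ W).symm ξ', fun f => ?_⟩
      have := Module.apply_evalEquiv_symm_apply (R := ℂ) (M := W) (f : W →ₗ[ℂ] ℂ) ξ'
      exact this
    refine ⟨(-q, p), ?_⟩
    ext w
    rw [hB]
    have h1 : φ (M w) = f w := by simp [φ, hP']
    have h2 : φ (M w) = p (M w).1 + ξ (M w).2 := by
      change _ = φ ((M w).1, 0) + φ (0, (M w).2)
      rw [← map_add]; simp
    rw [← h1, h2, ← hq]
    simp [omega]
  obtain ⟨N₀, hN₀⟩ := B.exists_rightInverse_of_surjective hsurj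
  have hN₀' : ∀ f w, omega (N₀ f) (M w) = f w := fun f w => by
    rw [← hB]
    exact congrArg (fun h : StrongDual ℂ W => h w) (LinearMap.congr_fun hN₀ f)
  -- correct the complement so that it becomes isotropic
  let c : StrongDual ℂ W →ₗ[ℂ] Module.Dual ℂ (Module.Dual ℂ W) :=
    { toFun := fun f =>
        { toFun := fun f' => (1 / 2 : ℂ) * omega (N₀ f) (N₀ (LinearMap.toContinuousLinearMap f'))
          map_add' := fun x y => by rw [map_add, map_add, omega_add_right, mul_add]
          map_smul' := fun c x => by
            rw [map_smul, map_smul, omega_smul_right, RingHom.id_apply, smul_eq_mul]; ring }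
      map_add' := fun x y => by
        ext f'; simp only [map_add, omega_add_left, mul_add]; rfl
      map_smul' := fun c x => by
        ext f'
        simp only [map_smul, omega_smul_left, RingHom.id_apply, LinearMap.smul_apply, smul_eq_mul]
        change (1 / 2 : ℂ) * (c * _) = c * ((1 / 2 : ℂ) * _)
        ring }
  let T : StrongDual ℂ W →ₗ[ℂ] W := (Module.evalEquiv ℂ W).symm.toLinearMap ∘ₗ c
  have hT : ∀ f f' : StrongDual ℂ W, f' (T f) = 1 / 2 * omega (N₀ f) (N₀ f') := by
    intro f f'
    exact Module.apply_evalEquiv_symm_apply (R := ℂ) (M := W) (f' : W →ₗ[ℂ] ℂ) (c f)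
  let N : StrongDual ℂ W →ₗ[ℂ] SympSpace W := N₀ + (M : W →ₗ[ℂ] SympSpace W) ∘ₗ T
  have hN : ∀ f, N f = N₀ f + M (T f) := fun f => rfl
  have hNM : ∀ f w, omega (N f) (M w) = f w := fun f w => by
    rw [hN, omega_add_left, hN₀', hiso, add_zero]
  have hMN : ∀ f w, omega (M w) (N f) = - f w := fun f w => by rw [omega_swap, hNM]
  have hNN : ∀ f f', omega (N f) (N f') = 0 := fun f f' => by
    rw [hN f', omega_add_right, hNM, hT, hN, omega_add_left, omega_swap (M _), hN₀', hT,
      omega_swap (N₀ f') (N₀ f)]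
    ring
  let G : SympSpace W →ₗ[ℂ] SympSpace W := LinearMap.coprod (M : W →ₗ[ℂ] SympSpace W) N
  have hG : ∀ u, G u = M u.1 + N u.2 := fun u => rfl
  have hGω : ∀ u v, omega (G u) (G v) = omega u v := fun u v => by
    rw [hG, hG, omega_add_left, omega_add_right, omega_add_right, hiso, hNN, hNM, hMN, omega]
    ring
  have hinj : Function.Injective G := by
    rw [injective_iff_map_eq_zero]
    intro v hv
    refine eq_zero_of_omega fun u => ?_
    rw [← hGω, hv]
    simp [omega]
  refine ⟨(LinearEquiv.ofInjectiveEndo G hinj).toContinuousLinearEquiv, ?_, ?_⟩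
  · exact fun u v => hGω u v
  · intro w
    change G (w, 0) = M w
    rw [hG]; simp

/-- The Lagrangian Grassmannian `LG(V)`: the linear subspaces of `V` which are equal to their
symplectic orthogonal complement. -/
def LagGrass (W : Type*) [NormedAddCommGroup W] [NormedSpace ℂ W] : Type _ :=
  {L : Submodule ℂ (SympSpace W) // ∀ v, v ∈ L ↔ ∀ u ∈ L, omega u v = 0}

/-- The image of a linear Lagrangian embedding of `W` is a Lagrangian subspace. -/
def LagGrass.ofEmbedding (M : W →L[ℂ] SympSpace W) (hM : Function.Injective M)
    (hiso : ∀ u v, omega (M u) (M v) = 0) : LagGrass W :=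
  ⟨LinearMap.range (M : W →ₗ[ℂ] SympSpace W), by
    obtain ⟨g, hg, hgM⟩ := exists_frame M hM hiso
    intro v
    constructor
    · rintro ⟨w, rfl⟩ _ ⟨w', rfl⟩
      exact hiso _ _
    · intro h
      have h1 : (g.symm v).2 = 0 := by
        ext w
        have h2 := h (M w) ⟨w, rfl⟩
        rw [← hgM, ← g.apply_symm_apply v, hg] at h2
        simpa [omega] using h2
      refine ⟨(g.symm v).1, ?_⟩
      change M _ = v
      rw [← hgM, ← h1]
      simp⟩

theorem LagGrass.exists_embedding (L : LagGrass W) : ∃ M : W →L[ℂ] SympSpace W,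
    Function.Injective M ∧ (∀ u v, omega (M u) (M v) = 0) ∧
      LinearMap.range (M : W →ₗ[ℂ] SympSpace W) = L.1 := by
  obtain ⟨L, hL⟩ := L
  let Ω : LinearMap.BilinForm ℂ (SympSpace W) := LinearMap.mk₂ ℂ omega omega_add_left
    omega_smul_left omega_add_right omega_smul_right
  have hrefl : Ω.IsRefl := fun u v h => by
    change omega v u = 0
    rw [omega_swap, show omega u v = 0 from h, neg_zero]
  have hnd : Ω.Nondegenerate := by
    refine hrefl.nondegenerate_iff_separatingRight.2 fun v hv => eq_zero_of_omega hv
  have horth : Ω.orthogonal L = L := by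
    ext v
    exact (hL v).symm
  have hfin := LinearMap.BilinForm.finrank_orthogonal hnd L
  rw [horth] at hfin
  have hdual : Module.finrank ℂ (StrongDual ℂ W) = Module.finrank ℂ W := by
    rw [← Subspace.dual_finrank_eq (K := ℂ) (V := W)]
    exact (LinearMap.toContinuousLinearMap (𝕜 := ℂ) (E := W) (F' := ℂ)).finrank_eq.symm
  have hV : Module.finrank ℂ (SympSpace W) = Module.finrank ℂ W + Module.finrank ℂ W := by
    rw [Module.finrank_prod, hdual]
  have hle : Module.finrank ℂ L ≤ Module.finrank ℂ (SympSpace W) := Submodule.finrank_le _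
  have hdim : Module.finrank ℂ W = Module.finrank ℂ L := by omega
  have : Module.Free ℂ L := Module.Free.of_divisionRing ℂ L
  let e : W ≃ₗ[ℂ] L := LinearEquiv.ofFinrankEq _ _ hdim
  refine ⟨LinearMap.toContinuousLinearMap (L.subtype ∘ₗ e.toLinearMap), ?_, ?_, ?_⟩
  · exact Subtype.val_injective.comp e.injective
  · intro u v
    exact (hL (e v)).1 (e v).2 _ (e u).2
  · ext v
    constructor
    · rintro ⟨w, rfl⟩
      exact (e w).2
    · intro hv
      exact ⟨e.symm ⟨v, hv⟩, by simp⟩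

end Symplectic

section Jets

variable {W : Type*} [NormedAddCommGroup W] [NormedSpace ℂ W]

/-- A (parametrized) germ at `0` of a Lagrangian submanifold of `V` passing through `0`: a
holomorphic immersion germ `(W, 0) → (V, 0)` which pulls the symplectic form back to `0`. Note that
`dim W` is half of `dim V`. -/
structure LagGerm (W : Type*) [NormedAddCommGroup W] [NormedSpace ℂ W] where
  toFun : W → SympSpace W
  analyticAt : AnalyticAt ℂ toFun 0
  map_zero : toFun 0 = 0
  injective : Function.Injective (fderiv ℂ toFun 0)
  isotropic : ∀ᶠ x in 𝓝 (0 : W), ∀ u v, omega (fderiv ℂ toFun x u) (fderiv ℂ toFun x v) = 0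

/-- The submanifold germs parametrized by `φ₁` and `φ₂` have the same `k`-jet at `0`: after a holomorphic change `ψ` of the parameter, the parametrizations
agree up to terms of order `k + 1`. -/
def Contact [FiniteDimensional ℂ W] (k : ℕ) (φ₁ φ₂ : LagGerm W) : Prop :=
  ∃ ψ : W → W, AnalyticAt ℂ ψ 0 ∧ ψ 0 = 0 ∧ (fderiv ℂ ψ 0).IsInvertible ∧
    (fun x => φ₂.toFun (ψ x) - φ₁.toFun x) =O[𝓝 0] fun x => ‖x‖ ^ (k + 1)

/-- The symplectic orthogonality relations for the graph of a closed `1`-form. -/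
theorem isotropic_graph {S : W → ℂ} (hS : ContDiff ℂ ω S) {g : SympSpace W ≃L[ℂ] SympSpace W}
    (hg : g ∈ Sp W) (x u v : W) :
    omega (fderiv ℂ (fun y => g (y, fderiv ℂ S y)) x u)
      (fderiv ℂ (fun y => g (y, fderiv ℂ S y)) x v) = 0 := by
  have hd : DifferentiableAt ℂ (fderiv ℂ S) x :=
    ((hS.fderiv_right (m := ω) le_top).differentiable (by simp)) x
  have h1 : HasFDerivAt (fun y => g (y, fderiv ℂ S y))
      ((g : SympSpace W →L[ℂ] SympSpace W) ∘L
        ((ContinuousLinearMap.id ℂ W).prod (fderiv ℂ (fderiv ℂ S) x))) x :=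
    g.hasFDerivAt.comp x ((hasFDerivAt_id x).prodMk hd.hasFDerivAt)
  rw [h1.fderiv]
  refine (hg _ _).trans ?_
  exact sub_eq_zero.2 ((hS.contDiffAt (x := x)).isSymmSndFDerivAt_of_omega u v)

/-- The germ of `g(graph of dF)`, where `F` is a polynomial on `W` without terms of degree `≤ 1`
and `g` is a linear symplectic automorphism of `V`. -/
def graphGerm {a b : ℕ} (ha : 2 ≤ a) (g : Sp W) (F : SymSum a b W) : LagGerm W where
  toFun x := g.1 (x, fderiv ℂ F.eval x)
  analyticAt := by
    have h : ContDiff ℂ ω (fun x => g.1 (x, fderiv ℂ F.eval x)) :=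
      g.1.contDiff.comp (contDiff_id.prodMk (F.contDiff.fderiv_right (m := ω) le_top))
    exact h.contDiffAt.analyticAt
  map_zero := by
    rw [F.fderiv_eval_zero ha]
    exact g.1.map_zero
  injective := by
    have hd : DifferentiableAt ℂ (fderiv ℂ F.eval) 0 :=
      ((F.contDiff.fderiv_right (m := ω) le_top).differentiable (by simp)) 0
    have h1 : HasFDerivAt (fun y => g.1 (y, fderiv ℂ F.eval y))
        ((g.1 : SympSpace W →L[ℂ] SympSpace W) ∘L
          ((ContinuousLinearMap.id ℂ W).prod (fderiv ℂ (fderiv ℂ F.eval) 0))) 0 :=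
      g.1.hasFDerivAt.comp 0 ((hasFDerivAt_id 0).prodMk hd.hasFDerivAt)
    rw [h1.fderiv]
    intro u v huv
    exact congrArg Prod.fst (g.1.injective huv)
  isotropic := Eventually.of_forall fun x u v => isotropic_graph F.contDiff g.2 x u v

/-- The germ of a linear Lagrangian subspace. -/
def linearGerm (M : W →L[ℂ] SympSpace W) (hM : Function.Injective M)
    (hiso : ∀ u v, omega (M u) (M v) = 0) : LagGerm W where
  toFun := M
  analyticAt := M.analyticAt 0
  map_zero := M.map_zero
  injective := by rw [M.fderiv]; exact hM
  isotropic := Eventually.of_forall fun x u v => by rw [M.fderiv]; exact hiso u v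

theorem isBigO_id_of_analyticAt {ψ : W → W} (h : AnalyticAt ℂ ψ 0) (h0 : ψ 0 = 0) :
    ψ =O[𝓝 0] fun x => x := by
  simpa [h0] using h.differentiableAt.isBigO_sub

theorem isBigO_comp_pow {E : Type*} [NormedAddCommGroup E] {f : W → E} {m : ℕ}
    (hf : f =O[𝓝 0] fun x => ‖x‖ ^ m) {ψ : W → W} (h : AnalyticAt ℂ ψ 0) (h0 : ψ 0 = 0) :
    (fun x => f (ψ x)) =O[𝓝 0] fun x => ‖x‖ ^ m := by
  have ht : Tendsto ψ (𝓝 0) (𝓝 0) := by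
    have := h.continuousAt.tendsto
    rwa [h0] at this
  exact (hf.comp_tendsto ht).trans ((isBigO_id_of_analyticAt h h0).norm_norm.pow m)

variable [FiniteDimensional ℂ W]

theorem Contact.refl (k : ℕ) (φ : LagGerm W) : Contact k φ φ := by
  refine ⟨id, analyticAt_id, rfl, ?_, ?_⟩
  · rw [fderiv_id]
    exact ⟨ContinuousLinearEquiv.refl ℂ W, rfl⟩
  · simpa using isBigO_zero (E' := SympSpace W) (fun x : W => ‖x‖ ^ (k + 1)) (𝓝 0)

theorem Contact.symm {k : ℕ} {φ₁ φ₂ : LagGerm W} (h : Contact k φ₁ φ₂) : Contact k φ₂ φ₁ := by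
  obtain ⟨ψ, han, h0, hi, hO⟩ := h
  obtain ⟨ρ, hρ, hρ0, hρi, hr, -⟩ := exists_local_inverse han hi
  rw [h0] at hρ hρ0 hρi hr
  refine ⟨ρ, hρ, hρ0, hρi, ?_⟩
  have h1 := (isBigO_comp_pow hO hρ hρ0).neg_left
  refine h1.congr' ?_ EventuallyEq.rfl
  filter_upwards [hr] with y hy
  rw [hy]; abel

theorem Contact.trans {k : ℕ} {φ₁ φ₂ φ₃ : LagGerm W} (h : Contact k φ₁ φ₂)
    (h' : Contact k φ₂ φ₃) : Contact k φ₁ φ₃ := by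
  obtain ⟨ψ, han, h0, hi, hO⟩ := h
  obtain ⟨ψ', han', h0', hi', hO'⟩ := h'
  have han'' : AnalyticAt ℂ ψ' (ψ 0) := by rwa [h0]
  refine ⟨ψ' ∘ ψ, han''.comp han, by simp [h0, h0'], ?_, ?_⟩
  · rw [fderiv_comp 0 han''.differentiableAt han.differentiableAt, h0]
    exact hi'.comp hi
  · refine ((isBigO_comp_pow hO' han h0).add hO).congr_left fun x => ?_
    simp

/-- Having the same `k`-jet, as an equivalence relation. -/
def contactSetoid (k : ℕ) (W : Type*) [NormedAddCommGroup W] [NormedSpace ℂ W]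
    [FiniteDimensional ℂ W] : Setoid (LagGerm W) where
  r := Contact k
  iseqv := ⟨Contact.refl k, Contact.symm, Contact.trans⟩

/-- The space `𝓛(V)` of `k`-jets at `0` of Lagrangian submanifolds of `V` passing through `0`. -/
def JetSpace (k : ℕ) (W : Type*) [NormedAddCommGroup W] [NormedSpace ℂ W]
    [FiniteDimensional ℂ W] : Type _ :=
  Quotient (contactSetoid k W)

/-- The `k`-jet of a Lagrangian germ. -/
def LagGerm.jet (k : ℕ) (φ : LagGerm W) : JetSpace k W := Quotient.mk (contactSetoid k W) φ

theorem LagGerm.jet_eq_iff {k : ℕ} {φ₁ φ₂ : LagGerm W} : φ₁.jet k = φ₂.jet k ↔ Contact k φ₁ φ₂ :=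
  Quotient.eq (r := contactSetoid k W)

/-- The tangent space at `0` of a Lagrangian germ, as a point of the Lagrangian Grassmannian. -/
def LagGerm.tangent (φ : LagGerm W) : LagGrass W :=
  LagGrass.ofEmbedding (fderiv ℂ φ.toFun 0) φ.injective φ.isotropic.self_of_nhds

/-- The inverse of a chart of `𝓛(V)`: it sends a polynomial `F` on `W` with terms in degrees
`2, …, k + 1` to the jet of `g(graph of dF)`. -/
def jetParam (k : ℕ) (g : Sp W) (F : SymSum 2 (k + 1) W) : JetSpace k W :=
  (graphGerm le_rfl g F).jet k

/-- The inverse of a chart of `LG(V)`: it sends a quadratic form `Q` on `W` to the linear Lagrangian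
subspace `g(graph of dQ)`. -/
def grassParam (g : Sp W) (Q : SymSum 2 2 W) : LagGrass W :=
  (graphGerm le_rfl g Q).tangent

/-- The embedding of `LG(V)` in `𝓛(V)`: a linear Lagrangian subspace is sent to its `k`-jet.
The chosen linear parametrization of the subspace does not affect the jet. -/
def toJet (k : ℕ) (L : LagGrass W) : JetSpace k W :=
  (linearGerm L.exists_embedding.choose L.exists_embedding.choose_spec.1
    L.exists_embedding.choose_spec.2.1).jet k

end Jets

section Taylor

variable {W : Type*} [NormedAddCommGroup W] [NormedSpace ℂ W]

theorem symm_of_closed {β : W → StrongDual ℂ W} (hβ : AnalyticAt ℂ β 0)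
    (hc : ∀ᶠ y in 𝓝 (0 : W), ∀ u v, fderiv ℂ β y u v = fderiv ℂ β y v u) (j : ℕ)
    (σ : Equiv.Perm (Fin (j + 1))) : ∀ v : Fin (j + 1) → W,
    iteratedFDeriv ℂ j β 0 (Fin.init fun i => v (σ i)) (v (σ (Fin.last j))) =
      iteratedFDeriv ℂ j β 0 (Fin.init v) (v (Fin.last j)) := by
  have hcd : ContDiffAt ℂ ω β 0 := hβ.contDiffAt
  have hσ : σ ∈ Submonoid.closure (Set.range fun i : Fin j => Equiv.swap i.castSucc i.succ) := by
    rw [Equiv.Perm.mclosure_swap_castSucc_succ]; trivial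
  induction hσ using Submonoid.closure_induction with
  | one => intro v; rfl
  | mul x y _ _ hx hy => intro v; exact (hy fun i => v (x i)).trans (hx v)
  | mem x hx =>
    obtain ⟨i, rfl⟩ := hx
    intro v
    obtain ⟨m, rfl⟩ : ∃ m, j = m + 1 := ⟨j - 1, by have := i.2; omega⟩
    induction i using Fin.lastCases with
    | last =>
      simp only [Fin.succ_last]
      rw [iteratedFDeriv_succ_apply_right, iteratedFDeriv_succ_apply_right]
      have h1 : (Fin.init (Fin.init fun i : Fin (m + 2) =>
          v (Equiv.swap (Fin.last m).castSucc (Fin.last (m + 1)) i))) = Fin.init (Fin.init v) := by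
        ext i
        simp only [Fin.init]
        rw [Equiv.swap_apply_of_ne_of_ne]
        · simp [Fin.ext_iff]; have := i.2; omega
        · simp [Fin.ext_iff]; have := i.2; omega
      rw [h1]
      simp only [Fin.init, Equiv.swap_apply_left, Equiv.swap_apply_right]
      -- the closedness relation
      let fl : (W →L[ℂ] StrongDual ℂ W) →L[ℂ] (W →L[ℂ] StrongDual ℂ W) :=
        (ContinuousLinearMap.flipₗᵢ ℂ W W ℂ).toContinuousLinearEquiv.toContinuousLinearMap
      have hfl : fl ∘ fderiv ℂ β =ᶠ[𝓝 0] fderiv ℂ β := by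
        filter_upwards [hc] with y hy
        ext a b
        exact hy b a
      have h2 := hfl.iteratedFDeriv ℂ m |>.self_of_nhds
      have h4 : iteratedFDeriv ℂ m (fl ∘ fderiv ℂ β) 0 =
          fl.compContinuousMultilinearMap (iteratedFDeriv ℂ m (fderiv ℂ β) 0) :=
        ContinuousLinearMap.iteratedFDeriv_comp_left (F := W →L[ℂ] StrongDual ℂ W)
          (G := W →L[ℂ] StrongDual ℂ W) (n := ω) fl hβ.fderiv.contDiffAt le_top
      rw [h4] at h2
      have h3 := congrArg (fun F => F (fun i : Fin m => v i.castSucc.castSucc)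
        (v (Fin.last m).castSucc) (v (Fin.last (m + 1)))) h2
      exact h3
    | cast i =>
      have h1 : (Fin.init fun l : Fin (m + 2) =>
          v (Equiv.swap i.castSucc.castSucc i.castSucc.succ l)) =
          (Fin.init v) ∘ (Equiv.swap i.castSucc i.succ) := by
        ext l
        simp only [Fin.init, Function.comp]
        rw [Fin.succ_castSucc, (Fin.castSucc_injective _).map_swap]
      have h2 : Equiv.swap i.castSucc.castSucc i.castSucc.succ (Fin.last (m + 1)) =
          Fin.last (m + 1) := by
        rw [Equiv.swap_apply_of_ne_of_ne]
        · simp [Fin.ext_iff]; have := i.2; omega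
        · simp [Fin.ext_iff]; have := i.2; omega
      rw [h1, h2, hcd.iteratedFDeriv_comp_perm]

/-- The coefficient of degree `i` of the primitive of the closed `1`-form `β`. -/
def primCoeff (β : W → StrongDual ℂ W) : (i : ℕ) →
    ContinuousMultilinearMap ℂ (fun _ : Fin i => W) ℂ
  | 0 => 0
  | j + 1 => ((j + 1).factorial : ℂ)⁻¹ •
      (continuousMultilinearCurryRightEquiv' ℂ j W ℂ).symm (iteratedFDeriv ℂ j β 0)

/-- The jet of a closed `1`-form is the differential of a polynomial. -/
theorem exists_primitive {β : W → StrongDual ℂ W} (hβ : AnalyticAt ℂ β 0) (h0 : β 0 = 0)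
    (hc : ∀ᶠ y in 𝓝 (0 : W), ∀ u v, fderiv ℂ β y u v = fderiv ℂ β y v u) (k : ℕ) :
    ∃ T : SymSum 2 (k + 1) W, (∀ i, (T i).1 = primCoeff β i) ∧
      (fun y => β y - fderiv ℂ T.eval y) =O[𝓝 0] fun y => ‖y‖ ^ (k + 1) := by
  have hsym : ∀ i, primCoeff β i ∈ SymForm i W := by
    intro i σ v
    cases i with
    | zero => rfl
    | succ j =>
      simp only [primCoeff, smul_apply]
      congr 1
      exact symm_of_closed hβ hc j σ v
  let T : SymSum 2 (k + 1) W := fun i => ⟨primCoeff β i, hsym i⟩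
  refine ⟨T, fun i => rfl, ?_⟩
  have hT : AnalyticAt ℂ (fderiv ℂ T.eval) 0 := (T.analyticAt 0).fderiv
  refine isBigO_pow_of_iteratedFDeriv (hβ.sub hT) fun j hj => ?_
  have h1 : iteratedFDeriv ℂ j (β - fderiv ℂ T.eval) 0 =
      iteratedFDeriv ℂ j β 0 - iteratedFDeriv ℂ j (fderiv ℂ T.eval) 0 :=
    iteratedFDeriv_sub_apply (hβ.contDiffAt.of_le le_top) (hT.contDiffAt.of_le le_top)
  change iteratedFDeriv ℂ j (β - fderiv ℂ T.eval) 0 = 0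
  rw [h1, sub_eq_zero]
  ext v w
  have h2 := iteratedFDeriv_succ_apply_right (𝕜 := ℂ) (f := T.eval) (x := 0) (n := j)
    (Fin.snoc v w : Fin (j + 1) → W)
  rw [T.iteratedFDeriv_eval, Fin.init_snoc, Fin.snoc_last] at h2
  refine Eq.trans ?_ h2
  by_cases hj0 : j = 0
  · subst hj0
    simp [SymSum.coeff, h0]
  · have hmem : j + 1 ∈ Finset.Icc 2 (k + 1) := Finset.mem_Icc.2 ⟨by omega, by omega⟩
    rw [SymSum.coeff, dif_pos hmem]
    change _ = _ * primCoeff β (j + 1) _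
    simp only [primCoeff, smul_apply, smul_eq_mul]
    rw [mul_inv_cancel_left₀ (Nat.cast_ne_zero.2 (Nat.factorial_ne_zero _))]
    rw [continuousMultilinearCurryRightEquiv_symm_apply', Fin.init_snoc, Fin.snoc_last]

end Taylor

section Charts

variable {W : Type*} [NormedAddCommGroup W] [NormedSpace ℂ W] [FiniteDimensional ℂ W]

theorem jet_eq_of_inverse (k : ℕ) (g : Sp W) (φ : LagGerm W) {ρ : W → W} (hρ : AnalyticAt ℂ ρ 0)
    (hρ0 : ρ 0 = 0) (hinv : ∀ᶠ y in 𝓝 (0 : W), (g.1.symm (φ.toFun (ρ y))).1 = y) :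
    ∃ T : SymSum 2 (k + 1) W,
      (∀ i, (T i).1 = primCoeff (fun y => (g.1.symm (φ.toFun (ρ y))).2) i) ∧
      φ.jet k = jetParam k g T := by
  set β : W → StrongDual ℂ W := fun y => (g.1.symm (φ.toFun (ρ y))).2 with hβdef
  have hφρ : AnalyticAt ℂ φ.toFun (ρ 0) := by rw [hρ0]; exact φ.analyticAt
  have hγ : AnalyticAt ℂ (fun y => g.1.symm (φ.toFun (ρ y))) 0 :=
    (g.1.symm.analyticAt _).fun_comp (hφρ.fun_comp hρ)
  have hβ : AnalyticAt ℂ β 0 := (ContinuousLinearMap.snd ℂ W (StrongDual ℂ W)).analyticAt _ |>.fun_comp hγ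
  have hβ0 : β 0 = 0 := by simp [hβdef, hρ0, φ.map_zero]
  have htend : Tendsto ρ (𝓝 0) (𝓝 0) := by
    have := hρ.continuousAt.tendsto
    rwa [hρ0] at this
  -- the derivative of the inverse parametrization
  have hev : ∀ᶠ y in 𝓝 (0 : W), ∀ w,
      g.1.symm (fderiv ℂ φ.toFun (ρ y) (fderiv ℂ ρ y w)) = (w, fderiv ℂ β y w) := by
    filter_upwards [hinv.eventually_nhds, htend.eventually φ.analyticAt.eventually_analyticAt,
      hρ.eventually_analyticAt, hβ.eventually_analyticAt] with y h1 h2 h3 h4 w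
    have h5 : HasFDerivAt (fun y => g.1.symm (φ.toFun (ρ y)))
        ((g.1.symm : SympSpace W →L[ℂ] SympSpace W) ∘L (fderiv ℂ φ.toFun (ρ y) ∘L fderiv ℂ ρ y)) y :=
      g.1.symm.hasFDerivAt.comp y (h2.differentiableAt.hasFDerivAt.comp y
        h3.differentiableAt.hasFDerivAt)
    have h6 : HasFDerivAt (fun y => g.1.symm (φ.toFun (ρ y)))
        ((ContinuousLinearMap.id ℂ W).prod (fderiv ℂ β y)) y := by
      refine ((hasFDerivAt_id y).prodMk h4.differentiableAt.hasFDerivAt).congr_of_eventuallyEq ?_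
      filter_upwards [h1] with z hz
      exact Prod.ext hz rfl
    exact congrArg (fun A : W →L[ℂ] SympSpace W => A w) (h5.unique h6)
  have hclosed : ∀ᶠ y in 𝓝 (0 : W), ∀ u v, fderiv ℂ β y u v = fderiv ℂ β y v u := by
    filter_upwards [hev, htend.eventually φ.isotropic] with y h1 h2 u v
    have h3 := h2 (fderiv ℂ ρ y u) (fderiv ℂ ρ y v)
    have h4 : fderiv ℂ φ.toFun (ρ y) (fderiv ℂ ρ y u) = g.1 (u, fderiv ℂ β y u) := by
      rw [← h1 u, g.1.apply_symm_apply]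
    have h5 : fderiv ℂ φ.toFun (ρ y) (fderiv ℂ ρ y v) = g.1 (v, fderiv ℂ β y v) := by
      rw [← h1 v, g.1.apply_symm_apply]
    rw [h4, h5, g.2] at h3
    exact sub_eq_zero.1 h3
  obtain ⟨T, hT, hTO⟩ := exists_primitive hβ hβ0 hclosed k
  refine ⟨T, hT, ?_⟩
  refine (LagGerm.jet_eq_iff.2 ⟨ρ, hρ, hρ0, ?_, ?_⟩).symm
  · have hinj : Function.Injective (fderiv ℂ ρ 0 : W →ₗ[ℂ] W) := by
      intro u v huv
      have h1 := hev.self_of_nhds u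
      have h2 := hev.self_of_nhds v
      have huv' : fderiv ℂ ρ 0 u = fderiv ℂ ρ 0 v := huv
      rw [huv', h2] at h1
      exact (congrArg Prod.fst h1).symm
    exact ⟨(LinearEquiv.ofInjectiveEndo _ hinj).toContinuousLinearEquiv, by ext; rfl⟩
  · have h1 : (fun y => (g.1 : SympSpace W →L[ℂ] SympSpace W) ((0 : W), β y - fderiv ℂ T.eval y))
        =O[𝓝 0] fun y => ‖y‖ ^ (k + 1) := by
      refine (((g.1 : SympSpace W →L[ℂ] SympSpace W).isBigO_comp _ _).trans ?_)
      refine IsBigO.trans ?_ hTO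
      exact (isBigO_zero _ _).prod_left (isBigO_refl _ _)
    refine h1.congr' ?_ EventuallyEq.rfl
    filter_upwards [hinv] with y hy
    have h2 : φ.toFun (ρ y) = g.1 (y, β y) := by
      rw [show (y, β y) = g.1.symm (φ.toFun (ρ y)) from Prod.ext hy.symm rfl,
        g.1.apply_symm_apply]
    rw [h2]
    change g.1 _ = g.1 _ - g.1 _
    rw [← map_sub]
    simp

theorem contact_fderiv {k : ℕ} (hk : 1 ≤ k) {φ₁ φ₂ : LagGerm W} {ψ : W → W}
    (hψ : AnalyticAt ℂ ψ 0) (hψ0 : ψ 0 = 0)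
    (hO : (fun x => φ₂.toFun (ψ x) - φ₁.toFun x) =O[𝓝 0] fun x => ‖x‖ ^ (k + 1)) (w : W) :
    fderiv ℂ φ₂.toFun 0 (fderiv ℂ ψ 0 w) = fderiv ℂ φ₁.toFun 0 w := by
  have hφ : AnalyticAt ℂ φ₂.toFun (ψ 0) := by rw [hψ0]; exact φ₂.analyticAt
  have h1 := iteratedFDeriv_eq_zero_of_isBigO ((hφ.fun_comp hψ).sub φ₁.analyticAt) hO 1 (by omega)
  have h2 := congrArg (fun A => A (fun _ => w)) h1
  simp only [iteratedFDeriv_one_apply] at h2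
  have h3 : HasFDerivAt (fun x => φ₂.toFun (ψ x) - φ₁.toFun x)
      (fderiv ℂ φ₂.toFun (ψ 0) ∘L fderiv ℂ ψ 0 - fderiv ℂ φ₁.toFun 0) 0 :=
    (hφ.differentiableAt.hasFDerivAt.comp 0 hψ.differentiableAt.hasFDerivAt).sub
      φ₁.analyticAt.differentiableAt.hasFDerivAt
  have h4 : fderiv ℂ (fun x => φ₂.toFun (ψ x) - φ₁.toFun x) 0 w = 0 := h2
  rw [h3.fderiv, hψ0] at h4
  exact sub_eq_zero.1 h4

theorem jetParam_surj (k : ℕ) (j : JetSpace k W) : ∃ g F, j = jetParam k g F := by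
  obtain ⟨φ, rfl⟩ := Quotient.exists_rep j
  obtain ⟨g, hg, hgM⟩ := exists_frame (fderiv ℂ φ.toFun 0) φ.injective φ.isotropic.self_of_nhds
  let a : W → W := fun x => (g.symm (φ.toFun x)).1
  have ha : AnalyticAt ℂ a 0 :=
    ((ContinuousLinearMap.fst ℂ W (StrongDual ℂ W)).analyticAt _).fun_comp
      ((g.symm.analyticAt _).fun_comp φ.analyticAt)
  have ha0 : a 0 = 0 := by simp [a, φ.map_zero]
  have hd : HasFDerivAt a ((ContinuousLinearMap.fst ℂ W (StrongDual ℂ W)) ∘L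
      ((g.symm : SympSpace W →L[ℂ] SympSpace W) ∘L fderiv ℂ φ.toFun 0)) 0 :=
    (ContinuousLinearMap.fst ℂ W (StrongDual ℂ W)).hasFDerivAt.comp 0
      (g.symm.hasFDerivAt.comp 0 φ.analyticAt.differentiableAt.hasFDerivAt)
  have hi : (fderiv ℂ a 0).IsInvertible := by
    rw [hd.fderiv]
    refine ⟨ContinuousLinearEquiv.refl ℂ W, ?_⟩
    ext w
    change w = (g.symm (fderiv ℂ φ.toFun 0 w)).1
    rw [← hgM, g.symm_apply_apply]
  obtain ⟨ρ, hρ, hρ0, -, hr, -⟩ := exists_local_inverse ha hi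
  rw [ha0] at hρ hρ0 hr
  obtain ⟨T, -, hT⟩ := jet_eq_of_inverse k ⟨g, hg⟩ φ hρ hρ0 hr
  exact ⟨⟨g, hg⟩, T, hT⟩

theorem jetParam_injective (k : ℕ) (g : Sp W) : Function.Injective (jetParam k g) := by
  intro F G h
  obtain ⟨ψ, hψ, hψ0, -, hO⟩ := LagGerm.jet_eq_iff.1 h
  have h1 : (fun x => (ψ x, fderiv ℂ G.eval (ψ x)) - (x, fderiv ℂ F.eval x))
      =O[𝓝 0] fun x => ‖x‖ ^ (k + 1) := by
    have h2 := ((g.1.symm : SympSpace W →L[ℂ] SympSpace W).isBigO_comp _ (𝓝 0)).trans hO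
    refine h2.congr_left fun x => ?_
    change g.1.symm (g.1 _ - g.1 _) = _
    rw [← map_sub, g.1.symm_apply_apply]
  have h2 : (fun x => ψ x - x) =O[𝓝 0] fun x => ‖x‖ ^ (k + 1) :=
    (isBigO_fst_prod (f' := fun x => ψ x - x)).trans h1
  have h3 : (fun x => fderiv ℂ G.eval (ψ x) - fderiv ℂ F.eval x)
      =O[𝓝 0] fun x => ‖x‖ ^ (k + 1) := (isBigO_snd_prod (g' := fun x =>
        fderiv ℂ G.eval (ψ x) - fderiv ℂ F.eval x) (f' := fun x => ψ x - x)).trans h1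
  have h4 : (fun x => fderiv ℂ G.eval (ψ x) - fderiv ℂ G.eval x)
      =O[𝓝 0] fun x => ψ x - x := by
    have h5 : HasStrictFDerivAt (fderiv ℂ G.eval) (fderiv ℂ (fderiv ℂ G.eval) 0) 0 :=
      (G.analyticAt 0).fderiv.hasStrictFDerivAt
    have ht : Tendsto (fun x => (ψ x, x)) (𝓝 0) (𝓝 ((0 : W), (0 : W))) := by
      have := hψ.continuousAt.tendsto
      rw [hψ0] at this
      exact this.prodMk_nhds tendsto_id
    exact h5.isBigO_sub.comp_tendsto ht
  refine SymSum.eq_of_isBigO ?_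
  refine ((h3.neg_left).add (h4.trans h2)).congr_left fun x => ?_
  abel

theorem contDiff_eval {W : Type*} [NormedAddCommGroup W] [NormedSpace ℂ W] {a b : ℕ} :
    ContDiff ℂ ω (fun p : SymSum a b W × W => p.1.eval p.2) := by
  unfold SymSum.eval
  refine ContDiff.sum fun i _ => ?_
  let P : SymSum a b W →L[ℂ] ContinuousMultilinearMap ℂ (fun _ : Fin (i : ℕ) => W) ℂ :=
    (SymForm (i : ℕ) W).subtypeL ∘L ContinuousLinearMap.proj i
  have h : ContDiff ℂ ω (fun q : SymSum a b W × (Fin (i : ℕ) → W) => P q.1 q.2) := by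
    refine contDiff_iff_contDiffAt.2 fun q => ?_
    have := ContinuousLinearMap.analyticAt_uncurry_of_multilinear (𝕜 := ℂ) (F := ℂ)
      (Em := fun _ : Fin (i : ℕ) => W) P (x := q)
    exact this.contDiffAt
  exact h.comp (contDiff_fst.prodMk (contDiff_pi.2 fun _ => contDiff_snd))

theorem contDiff_graph {W : Type*} [NormedAddCommGroup W] [NormedSpace ℂ W] {a b : ℕ} :
    ContDiff ℂ ω (fun p : SymSum a b W × W => (p.2, fderiv ℂ p.1.eval p.2)) := by
  refine contDiff_snd.prodMk ?_
  refine ContDiff.fderiv (𝕜 := ℂ) (n := ω) (f := fun (p : SymSum a b W × W) (y : W) => p.1.eval y)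
    (g := fun p => p.2) ?_ contDiff_snd le_top
  exact contDiff_eval.comp ((contDiff_fst.comp contDiff_fst).prodMk contDiff_snd)

theorem contDiffAt_iteratedFDeriv_param {W P X : Type*} [NormedAddCommGroup W]
    [NormedSpace ℂ W] [NormedAddCommGroup P] [NormedSpace ℂ P]
    [NormedAddCommGroup X] [NormedSpace ℂ X] {B : P × W → X} {z : P × W}
    (hB : ContDiffAt ℂ ω B z) (j : ℕ) :
    ContDiffAt ℂ ω (fun p : P × W => iteratedFDeriv ℂ j (fun y => B (p.1, y)) p.2) z := by
  induction j with
  | zero =>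
    exact (continuousMultilinearCurryFin0 ℂ W X).symm.contDiff.contDiffAt.comp z hB
  | succ j ih =>
    have h1 : ContDiffAt ℂ ω (fun p : P × W =>
        fderiv ℂ (fun y' => iteratedFDeriv ℂ j (fun y => B (p.1, y)) y') p.2) z := by
      refine ContDiffAt.fderiv (𝕜 := ℂ) (n := ω)
        (f := fun (p : P × W) (y' : W) => iteratedFDeriv ℂ j (fun y => B (p.1, y)) y')
        (g := fun p => p.2) ?_ contDiffAt_snd le_top
      exact ContDiffAt.comp (z, z.2) (g := fun p : P × W =>
        iteratedFDeriv ℂ j (fun y => B (p.1, y)) p.2) ih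
        ((contDiffAt_fst.comp _ contDiffAt_fst).prodMk contDiffAt_snd)
    exact (continuousMultilinearCurryLeftEquiv ℂ (fun _ : Fin (j + 1) => W)
      X).symm.contDiff.contDiffAt.comp z h1

theorem finiteDimensional_multilinear (i : ℕ) :
    FiniteDimensional ℂ (ContinuousMultilinearMap ℂ (fun _ : Fin i => W) ℂ) := by
  let f : ContinuousMultilinearMap ℂ (fun _ : Fin i => W) ℂ →ₗ[ℂ]
      MultilinearMap ℂ (fun _ : Fin i => W) ℂ :=
    { toFun := fun g => g.toMultilinearMap
      map_add' := fun _ _ => rfl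
      map_smul' := fun _ _ => rfl }
  exact FiniteDimensional.of_injective f ContinuousMultilinearMap.toMultilinearMap_injective

theorem exists_symmetrization (i : ℕ) :
    ∃ p : ContinuousMultilinearMap ℂ (fun _ : Fin i => W) ℂ →L[ℂ] SymForm i W,
      ∀ f : SymForm i W, p f.1 = f := by
  have := finiteDimensional_multilinear (W := W) i
  exact Submodule.ClosedComplemented.of_finiteDimensional (SymForm i W)

theorem exists_fiber_inverse {P : Type*} [NormedAddCommGroup P] [NormedSpace ℂ P] [CompleteSpace P]
    {a : P × W → W} (ha : ContDiff ℂ ω a) (ha0 : ∀ F, a (F, 0) = 0) (F₀ : P) (e : W ≃L[ℂ] W)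
    (he : ∀ w, fderiv ℂ (fun x => a (F₀, x)) 0 w = e w) :
    ∃ r : P × W → W, AnalyticAt ℂ r (F₀, 0) ∧ ∀ᶠ F in 𝓝 F₀,
      AnalyticAt ℂ (fun y => r (F, y)) 0 ∧ r (F, 0) = 0 ∧
        ∀ᶠ y in 𝓝 (0 : W), a (F, r (F, y)) = y := by
  let Θ : P × W → P × W := fun p => (p.1, a p)
  have hΘ : ContDiff ℂ ω Θ := contDiff_fst.prodMk ha
  have hΘ0 : ∀ F : P, Θ (F, 0) = (F, 0) := fun F => by simp [Θ, ha0]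
  have hder : (fderiv ℂ Θ (F₀, 0)).IsInvertible := by
    have had : HasFDerivAt a (fderiv ℂ a (F₀, 0)) (F₀, 0) :=
      (ha.contDiffAt.differentiableAt (by simp)).hasFDerivAt
    have h1 : ∀ δ, fderiv ℂ a (F₀, 0) (δ, 0) = 0 := by
      intro δ
      have h2 : HasFDerivAt (fun F : P => a (F, (0 : W)))
          (fderiv ℂ a (F₀, 0) ∘L ContinuousLinearMap.inl ℂ P W) F₀ :=
        HasFDerivAt.comp F₀ (f := fun F : P => (F, (0 : W))) had (hasFDerivAt_prodMk_left F₀ 0)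
      have h3 : (fun F : P => a (F, 0)) = fun _ => 0 := funext ha0
      rw [h3] at h2
      exact congrArg (fun A : P →L[ℂ] W => A δ) (h2.unique (hasFDerivAt_const _ _))
    have h4 : ∀ w, fderiv ℂ a (F₀, 0) (0, w) = e w := by
      intro w
      have h2 : HasFDerivAt (fun x : W => a (F₀, x))
          (fderiv ℂ a (F₀, 0) ∘L ContinuousLinearMap.inr ℂ P W) 0 :=
        HasFDerivAt.comp (0 : W) (f := fun x : W => (F₀, x)) had (hasFDerivAt_prodMk_right F₀ 0)
      have h3 := he w
      rw [h2.fderiv] at h3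
      exact h3
    have h5 : HasFDerivAt Θ ((ContinuousLinearMap.fst ℂ P W).prod (fderiv ℂ a (F₀, 0))) (F₀, 0) :=
      hasFDerivAt_fst.prodMk had
    rw [h5.fderiv]
    refine ⟨(ContinuousLinearEquiv.refl ℂ P).prodCongr e, ?_⟩
    refine ContinuousLinearMap.ext fun p => ?_
    have h6 : fderiv ℂ a (F₀, 0) p = e p.2 := by
      have h7 : p = (p.1, 0) + (0, p.2) := by simp
      conv_lhs => rw [h7, map_add, h1, h4, zero_add]
    exact Prod.ext rfl h6.symm
  obtain ⟨R, hR, -, -, hRr, hRl⟩ := exists_local_inverse hΘ.contDiffAt.analyticAt hder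
  rw [hΘ0] at hR hRr
  refine ⟨fun p => (R p).2, analyticAt_snd.fun_comp hR, ?_⟩
  have hz : Tendsto (fun F : P => (F, (0 : W))) (𝓝 F₀) (𝓝 (F₀, 0)) :=
    (continuous_id.prodMk continuous_const).tendsto F₀
  have hRr' : ∀ᶠ F in 𝓝 F₀, ∀ᶠ y in 𝓝 (0 : W), Θ (R (F, y)) = (F, y) := by
    rw [nhds_prod_eq] at hRr
    exact hRr.curry
  filter_upwards [hRr', hz.eventually hRl, hz.eventually hR.eventually_analyticAt]
    with F h1 h2 h3
  rw [hΘ0] at h2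
  refine ⟨?_, by simp [h2], ?_⟩
  · have h4 : AnalyticAt ℂ (fun y : W => (F, y)) 0 := analyticAt_const.prod analyticAt_id
    exact analyticAt_snd.fun_comp (AnalyticAt.fun_comp (g := R) h3 h4)
  · filter_upwards [h1] with y hy
    have h4 : (R (F, y)).1 = F := congrArg Prod.fst hy
    have h5 : a (R (F, y)) = y := congrArg Prod.snd hy
    rwa [← Prod.mk.eta (p := R (F, y)), h4] at h5

/-- If the jets of two graphs agree, then the first one is transverse to the second vertical
subspace. -/
theorem exists_horizontal_equiv {k : ℕ} (hk : 1 ≤ k) {g g' : Sp W} {F₀ F₁ : SymSum 2 (k + 1) W}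
    (h : jetParam k g F₀ = jetParam k g' F₁) : ∃ e : W ≃L[ℂ] W, ∀ w,
      fderiv ℂ (fun x => (g'.1.symm (g.1 (x, fderiv ℂ F₀.eval x))).1) 0 w = e w := by
  obtain ⟨ψ, hψ, hψ0, ⟨e, he⟩, hO⟩ := LagGerm.jet_eq_iff.1 h
  refine ⟨e, fun w => ?_⟩
  have h1 := contact_fderiv hk hψ hψ0 hO w
  have h2 : HasFDerivAt (fun x => (g'.1.symm (g.1 (x, fderiv ℂ F₀.eval x))).1)
      ((ContinuousLinearMap.fst ℂ W (StrongDual ℂ W)) ∘L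
      ((g'.1.symm : SympSpace W →L[ℂ] SympSpace W) ∘L
        fderiv ℂ (graphGerm le_rfl g F₀).toFun 0)) 0 :=
    (ContinuousLinearMap.fst ℂ W (StrongDual ℂ W)).hasFDerivAt.comp 0
      (g'.1.symm.hasFDerivAt.comp 0
        (graphGerm le_rfl g F₀).analyticAt.differentiableAt.hasFDerivAt)
  have h3 : HasFDerivAt (fun x => (g'.1.symm ((graphGerm le_rfl g' F₁).toFun x)).1)
      ((ContinuousLinearMap.fst ℂ W (StrongDual ℂ W)) ∘L
      ((g'.1.symm : SympSpace W →L[ℂ] SympSpace W) ∘L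
        fderiv ℂ (graphGerm le_rfl g' F₁).toFun 0)) 0 :=
    (ContinuousLinearMap.fst ℂ W (StrongDual ℂ W)).hasFDerivAt.comp 0
      (g'.1.symm.hasFDerivAt.comp 0
        (graphGerm le_rfl g' F₁).analyticAt.differentiableAt.hasFDerivAt)
  have h4 : (fun x => (g'.1.symm ((graphGerm le_rfl g' F₁).toFun x)).1) = id := by
    funext x
    simp [graphGerm]
  rw [h4] at h3
  have h5 := h3.unique (hasFDerivAt_id 0)
  have h6 := congrArg (fun A : W →L[ℂ] W => A (fderiv ℂ ψ 0 w)) h5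
  rw [h2.fderiv]
  change (g'.1.symm (fderiv ℂ (graphGerm le_rfl g F₀).toFun 0 w)).1 = _
  rw [← h1]
  refine h6.trans ?_
  rw [← he]
  rfl

theorem completeSpace_symSum (a b : ℕ) : CompleteSpace (SymSum a b W) := by
  have h : ∀ i, CompleteSpace (SymForm i W) := fun i => by
    have := finiteDimensional_multilinear (W := W) i
    exact (Submodule.complete_of_finiteDimensional (SymForm i W)).completeSpace_coe
  infer_instance

/-- Changes of charts on `𝓛(V)` are defined on open sets and holomorphic. -/
theorem jetParam_transition {k : ℕ} (g g' : Sp W) (F₀ : SymSum 2 (k + 1) W)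
    (h : jetParam k g F₀ ∈ Set.range (jetParam k g')) :
    ∃ τ : SymSum 2 (k + 1) W → SymSum 2 (k + 1) W, ContDiffAt ℂ ω τ F₀ ∧
      ∀ᶠ F in 𝓝 F₀, jetParam k g F = jetParam k g' (τ F) := by
  rcases Nat.eq_zero_or_pos k with rfl | hk
  · refine ⟨id, contDiffAt_id, Eventually.of_forall fun F => ?_⟩
    refine LagGerm.jet_eq_iff.2 ⟨id, analyticAt_id, rfl, ?_, ?_⟩
    · rw [fderiv_id]
      exact ⟨ContinuousLinearEquiv.refl ℂ W, rfl⟩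
    · have h1 := (graphGerm le_rfl g F).analyticAt.differentiableAt.isBigO_sub
      have h2 := (graphGerm le_rfl g' F).analyticAt.differentiableAt.isBigO_sub
      simp only [LagGerm.map_zero, sub_zero] at h1 h2
      simpa using (h2.sub h1).norm_right
  obtain ⟨F₁, hF₁⟩ := h
  obtain ⟨e, he⟩ := exists_horizontal_equiv hk hF₁.symm
  let P := SymSum 2 (k + 1) W
  -- the two components of the graphs in the target frame
  let u : P × W → SympSpace W := fun p => g'.1.symm (g.1 (p.2, fderiv ℂ p.1.eval p.2))
  have hu : ContDiff ℂ ω u := g'.1.symm.contDiff.comp (g.1.contDiff.comp contDiff_graph)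
  have hu0 : ∀ F : P, u (F, 0) = 0 := fun F => by
    simp [u, SymSum.fderiv_eval_zero le_rfl]
  let a : P × W → W := fun p => (u p).1
  have ha : ContDiff ℂ ω a := contDiff_fst.comp hu
  have ha0 : ∀ F : P, a (F, 0) = 0 := fun F => by simp [a, hu0]
  have := completeSpace_symSum (W := W) 2 (k + 1)
  obtain ⟨r, hr, hrF⟩ := exists_fiber_inverse ha ha0 F₀ e he
  -- the family of graph functions in the target frame
  let B : P × W → StrongDual ℂ W := fun p => (u (p.1, r p)).2
  have hB : ContDiffAt ℂ ω B (F₀, 0) := by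
    have h1 : ContDiffAt ℂ ω (fun p : P × W => (p.1, r p)) (F₀, 0) :=
      contDiffAt_fst.prodMk hr.contDiffAt
    exact contDiffAt_snd.comp _ (hu.contDiffAt.comp _ h1)
  choose p hp using fun i : Finset.Icc 2 (k + 1) => exists_symmetrization (W := W) i
  have hpc : ∀ i, ContDiff ℂ ω (p i) := fun i =>
    ContinuousLinearMap.contDiff (𝕜 := ℂ) (E := ContinuousMultilinearMap ℂ (fun _ : Fin (i : ℕ) => W) ℂ)
      (F := SymForm (i : ℕ) W) (p i)
  refine ⟨fun F i => p i (primCoeff (fun y => B (F, y)) i), ?_, ?_⟩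
  · refine contDiffAt_pi.2 fun i => ContDiffAt.comp F₀ (g := p i)
      (f := fun F => primCoeff (fun y => B (F, y)) i) (hpc i).contDiffAt ?_
    obtain ⟨j, hj⟩ : ∃ j, (i : ℕ) = j + 1 :=
      ⟨i - 1, by have := (Finset.mem_Icc.1 i.2).1; omega⟩
    have h1 := contDiffAt_iteratedFDeriv_param hB j
    have h2 : ContDiffAt ℂ ω (fun F : P => iteratedFDeriv ℂ j (fun y => B (F, y)) 0) F₀ :=
      ContDiffAt.comp F₀ (g := fun p : P × W => iteratedFDeriv ℂ j (fun y => B (p.1, y)) p.2)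
        (f := fun F => (F, (0 : W))) h1 (contDiffAt_id.prodMk contDiffAt_const)
    have h3 : ∀ l, l = j + 1 → ContDiffAt ℂ ω (fun F : P => primCoeff (fun y => B (F, y)) l) F₀ := by
      rintro l rfl
      have h4 := (continuousMultilinearCurryRightEquiv' ℂ j W ℂ).symm.contDiff.contDiffAt.comp F₀ h2
      exact ContDiffAt.const_smul (R := ℂ) (((j + 1).factorial : ℂ)⁻¹) h4
    exact h3 _ hj
  · filter_upwards [hrF] with F ⟨hρ, hρ0, hinv⟩
    obtain ⟨T, hT, hTj⟩ := jet_eq_of_inverse k g' (graphGerm le_rfl g F) hρ hρ0 hinv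
    refine hTj.trans (congrArg _ ?_)
    funext i
    rw [← hp i (T i), hT]
    rfl

end Charts

section Atlas

variable {I E X : Type*} [NormedAddCommGroup E] [NormedSpace ℂ E]

/-- A family of parametrizations `c i : E → X` of subsets of `X` by the whole vector space `E` is
holomorphic if the maps `c i` are injective, their images cover `X`, and the changes of parameters
are holomorphic maps with open domains of definition. -/
structure HolParam (c : I → E → X) : Prop where
  injective : ∀ i, Function.Injective (c i)
  surjective : ∀ x, ∃ i y, x = c i y
  transition : ∀ i j y, c i y ∈ Set.range (c j) →
    ∃ τ : E → E, ContDiffAt ℂ ω τ y ∧ ∀ᶠ z in 𝓝 y, c i z = c j (τ z)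

namespace HolParam

variable {c : I → E → X}

/-- The chart `(c i)⁻¹`, with domain the image of `c i`. -/
def chart (h : HolParam c) (i : I) : PartialEquiv X E where
  toFun := Function.invFun (c i)
  invFun := c i
  source := Set.range (c i)
  target := Set.univ
  map_source' _ _ := trivial
  map_target' y _ := ⟨y, rfl⟩
  left_inv' _ hx := Function.invFun_eq hx
  right_inv' y _ := Function.leftInverse_invFun (h.injective i) y

theorem trans_source (h : HolParam c) (i j : I) :
    ((h.chart i).symm.trans (h.chart j)).source = c i ⁻¹' Set.range (c j) := by
  rw [PartialEquiv.trans_source]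
  exact Set.univ_inter _

theorem isOpen_trans_source (h : HolParam c) (i j : I) :
    IsOpen ((h.chart i).symm.trans (h.chart j)).source := by
  rw [trans_source, isOpen_iff_mem_nhds]
  intro y hy
  obtain ⟨τ, -, hτ⟩ := h.transition i j y hy
  filter_upwards [hτ] with z hz
  exact ⟨τ z, hz.symm⟩

theorem contDiffOn_trans (h : HolParam c) (i j : I) :
    ContDiffOn ℂ ω ((h.chart i).symm.trans (h.chart j))
      ((h.chart i).symm.trans (h.chart j)).source := by
  intro y hy
  rw [trans_source] at hy
  obtain ⟨τ, hτ, hτ'⟩ := h.transition i j y hy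
  refine (hτ.congr_of_eventuallyEq ?_).contDiffWithinAt
  filter_upwards [hτ'] with z hz
  change Function.invFun (c j) (c i z) = τ z
  rw [hz]
  exact Function.leftInverse_invFun (h.injective j) _

/-- The complex manifold structure with the charts `(c i)⁻¹`. -/
def core (h : HolParam c) : ChartedSpaceCore E X where
  atlas := Set.range h.chart
  chartAt x := h.chart (h.surjective x).choose
  mem_chart_source x := by
    obtain ⟨y, hy⟩ := (h.surjective x).choose_spec
    exact ⟨y, hy.symm⟩
  chart_mem_atlas _ := ⟨_, rfl⟩
  open_source := by
    rintro _ _ ⟨i, rfl⟩ ⟨j, rfl⟩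
    exact h.isOpen_trans_source i j
  continuousOn_toFun := by
    rintro _ _ ⟨i, rfl⟩ ⟨j, rfl⟩
    exact (h.contDiffOn_trans i j).continuousOn

theorem isManifold_core (h : HolParam c) :
    @IsManifold ℂ _ E _ _ E _ 𝓘(ℂ, E) ω X h.core.toTopologicalSpace h.core.toChartedSpace := by
  let := h.core.toTopologicalSpace
  let := h.core.toChartedSpace
  refine isManifold_of_contDiffOn _ _ _ ?_
  intro e e' he he'
  obtain ⟨f, ⟨i, rfl⟩, rfl⟩ : ∃ f, ∃ hf : f ∈ h.core.atlas, h.core.openPartialHomeomorph f hf = e := by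
    have he2 : e ∈ ⋃ (f : PartialEquiv X E) (hf : f ∈ h.core.atlas),
      {h.core.openPartialHomeomorph f hf} := he
    simp only [Set.mem_iUnion, Set.mem_singleton_iff] at he2
    obtain ⟨f, hf, hfe⟩ := he2
    exact ⟨f, hf, hfe.symm⟩
  obtain ⟨f, ⟨j, rfl⟩, rfl⟩ : ∃ f, ∃ hf : f ∈ h.core.atlas, h.core.openPartialHomeomorph f hf = e' := by
    have he2 : e' ∈ ⋃ (f : PartialEquiv X E) (hf : f ∈ h.core.atlas),
      {h.core.openPartialHomeomorph f hf} := he'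
    simp only [Set.mem_iUnion, Set.mem_singleton_iff] at he2
    obtain ⟨f, hf, hfe⟩ := he2
    exact ⟨f, hf, hfe.symm⟩
  have := h.contDiffOn_trans i j
  simp only [modelWithCornersSelf_coe, modelWithCornersSelf_coe_symm, Set.range_id,
    Set.inter_univ, Set.preimage_id_eq, id_eq, Function.comp_id, Function.id_comp]
  exact this

end HolParam

end Atlas

section Manifolds

variable {W : Type*} [NormedAddCommGroup W] [NormedSpace ℂ W] [FiniteDimensional ℂ W]

theorem tangent_eq_iff {φ₁ φ₂ : LagGerm W} : φ₁.tangent = φ₂.tangent ↔ φ₁.jet 1 = φ₂.jet 1 := by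
  have key : ∀ {φ₁ φ₂ : LagGerm W}, φ₁.jet 1 = φ₂.jet 1 → φ₁.tangent.1 ≤ φ₂.tangent.1 := by
    intro φ₁ φ₂ h
    obtain ⟨ψ, hψ, hψ0, -, hO⟩ := LagGerm.jet_eq_iff.1 h
    rintro _ ⟨w, rfl⟩
    exact ⟨fderiv ℂ ψ 0 w, contact_fderiv le_rfl hψ hψ0 hO w⟩
  refine ⟨fun h => ?_, fun h => Subtype.ext (le_antisymm (key h) (key h.symm))⟩
  have hr : LinearMap.range (fderiv ℂ φ₁.toFun 0 : W →ₗ[ℂ] SympSpace W) =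
      LinearMap.range (fderiv ℂ φ₂.toFun 0 : W →ₗ[ℂ] SympSpace W) := congrArg Subtype.val h
  obtain ⟨A, hA⟩ : ∃ A : W →ₗ[ℂ] W, ∀ w, fderiv ℂ φ₂.toFun 0 (A w) = fderiv ℂ φ₁.toFun 0 w := by
    obtain ⟨P, hP⟩ := (fderiv ℂ φ₂.toFun 0 : W →ₗ[ℂ] SympSpace W).exists_leftInverse_of_injective
      (LinearMap.ker_eq_bot.2 φ₂.injective)
    refine ⟨P ∘ₗ (fderiv ℂ φ₁.toFun 0 : W →ₗ[ℂ] SympSpace W), fun w => ?_⟩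
    have hw : fderiv ℂ φ₁.toFun 0 w ∈ LinearMap.range
      (fderiv ℂ φ₂.toFun 0 : W →ₗ[ℂ] SympSpace W) := hr ▸ ⟨w, rfl⟩
    obtain ⟨v, hv⟩ := hw
    have hPv : P (fderiv ℂ φ₂.toFun 0 v) = v := LinearMap.congr_fun hP v
    have hv' : fderiv ℂ φ₂.toFun 0 v = fderiv ℂ φ₁.toFun 0 w := hv
    change fderiv ℂ φ₂.toFun 0 (P (fderiv ℂ φ₁.toFun 0 w)) = _
    rw [← hv', hPv]
  have hinj : Function.Injective A := fun u v huv => φ₁.injective (by rw [← hA, ← hA, huv])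
  let e : W ≃L[ℂ] W := (LinearEquiv.ofInjectiveEndo A hinj).toContinuousLinearEquiv
  have he : ∀ w, e w = A w := fun w => rfl
  refine LagGerm.jet_eq_iff.2 ⟨e, e.analyticAt 0, e.map_zero, ?_, ?_⟩
  · rw [e.fderiv]
    exact ContinuousLinearMap.isInvertible_equiv
  · have h2 : AnalyticAt ℂ φ₂.toFun (e 0) := by rw [e.map_zero]; exact φ₂.analyticAt
    refine isBigO_pow_of_iteratedFDeriv ((h2.fun_comp (e.analyticAt 0)).sub φ₁.analyticAt)
      fun i hi => ?_
    have h3 : HasFDerivAt (fun x => φ₂.toFun (e x) - φ₁.toFun x)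
        (fderiv ℂ φ₂.toFun (e 0) ∘L (e : W →L[ℂ] W) - fderiv ℂ φ₁.toFun 0) 0 :=
      (h2.differentiableAt.hasFDerivAt.comp 0 e.hasFDerivAt).sub
        φ₁.analyticAt.differentiableAt.hasFDerivAt
    change iteratedFDeriv ℂ i (fun x => φ₂.toFun (e x) - φ₁.toFun x) 0 = 0
    interval_cases i
    · refine ContinuousMultilinearMap.ext fun v => ?_
      simp [φ₁.map_zero, φ₂.map_zero]
    · refine ContinuousMultilinearMap.ext fun v => ?_
      rw [iteratedFDeriv_one_apply, h3.fderiv, e.map_zero]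
      exact sub_eq_zero.2 ((congrArg _ (he _)).trans (hA _))

theorem jetParam_holParam (k : ℕ) (W : Type*) [NormedAddCommGroup W] [NormedSpace ℂ W]
    [FiniteDimensional ℂ W] : HolParam (jetParam k : Sp W → _ → _) where
  injective := jetParam_injective k
  surjective := jetParam_surj k
  transition g g' F h := jetParam_transition g g' F h

theorem grassParam_eq_iff {g g' : Sp W} {Q Q' : SymSum 2 2 W} :
    grassParam g Q = grassParam g' Q' ↔ jetParam 1 g Q = jetParam 1 g' Q' :=
  tangent_eq_iff

theorem grassParam_holParam (W : Type*) [NormedAddCommGroup W] [NormedSpace ℂ W]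
    [FiniteDimensional ℂ W] : HolParam (grassParam : Sp W → _ → _) where
  injective g Q Q' h := jetParam_injective 1 g (grassParam_eq_iff.1 h)
  surjective L := by
    obtain ⟨M, hM, hiso, hr⟩ := L.exists_embedding
    obtain ⟨g, Q, hQ⟩ := jetParam_surj 1 ((linearGerm M hM hiso).jet 1)
    refine ⟨g, Q, ?_⟩
    have h1 : (linearGerm M hM hiso).tangent = grassParam g Q := tangent_eq_iff.2 hQ
    rw [← h1]
    refine Subtype.ext ?_
    change L.1 = LinearMap.range (fderiv ℂ M 0 : W →ₗ[ℂ] SympSpace W)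
    rw [M.fderiv, hr]
  transition g g' Q h := by
    obtain ⟨Q', hQ'⟩ := h
    obtain ⟨τ, hτ, h⟩ := jetParam_transition (k := 1) g g' Q ⟨Q', grassParam_eq_iff.1 hQ'⟩
    exact ⟨τ, hτ, h.mono fun z hz => grassParam_eq_iff.2 hz⟩

/-- The complex manifold structure of `𝓛(V)`, with the charts inverse to `jetParam k g`. -/
instance (k : ℕ) : TopologicalSpace (JetSpace k W) := (jetParam_holParam k W).core.toTopologicalSpace

instance (k : ℕ) : ChartedSpace (SymSum 2 (k + 1) W) (JetSpace k W) :=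
  (jetParam_holParam k W).core.toChartedSpace

instance (k : ℕ) : IsManifold 𝓘(ℂ, SymSum 2 (k + 1) W) ω (JetSpace k W) :=
  (jetParam_holParam k W).isManifold_core

/-- The complex manifold structure of `LG(V)`, with the charts inverse to `grassParam g`. -/
instance : TopologicalSpace (LagGrass W) := (grassParam_holParam W).core.toTopologicalSpace

instance : ChartedSpace (SymSum 2 2 W) (LagGrass W) := (grassParam_holParam W).core.toChartedSpace

instance : IsManifold 𝓘(ℂ, SymSum 2 2 W) ω (LagGrass W) := (grassParam_holParam W).isManifold_core

end Manifolds

section Bundles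

variable {W : Type*} [NormedAddCommGroup W] [NormedSpace ℂ W] [FiniteDimensional ℂ W]

/-- The fibre at `L` of the normal bundle `N_G 𝓛 = T𝓛|_G / TG` of `G = LG(V)` in `𝓛 = 𝓛(V)`. -/
abbrev NormalSpace (k : ℕ) (L : LagGrass W) : Type _ :=
  TangentSpace 𝓘(ℂ, SymSum 2 (k + 1) W) (toJet k L) ⧸
    LinearMap.range (mfderiv 𝓘(ℂ, SymSum 2 2 W) 𝓘(ℂ, SymSum 2 (k + 1) W) (toJet k) L).toLinearMap

/-- The class in the normal space of a tangent vector of `𝓛(V)` at a point of `LG(V)`. -/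
def normalClass (k : ℕ) (L : LagGrass W)
    (v : TangentSpace 𝓘(ℂ, SymSum 2 (k + 1) W) (toJet k L)) : NormalSpace k L :=
  Submodule.Quotient.mk v

/-- Holomorphy near `L₀` of a section of the normal bundle: locally, the section lifts to a
holomorphic section of the restriction of the tangent bundle of `𝓛(V)` to `LG(V)`. -/
def NormalHolomorphicAt (k : ℕ) (s : (L : LagGrass W) → NormalSpace k L) (L₀ : LagGrass W) : Prop :=
  ∃ t : (L : LagGrass W) → TangentSpace 𝓘(ℂ, SymSum 2 (k + 1) W) (toJet k L),
    ContMDiffAt 𝓘(ℂ, SymSum 2 2 W) 𝓘(ℂ, SymSum 2 (k + 1) W).tangent ω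
      (fun L => (⟨toJet k L, t L⟩ : TangentBundle 𝓘(ℂ, SymSum 2 (k + 1) W) (JetSpace k W))) L₀ ∧
    ∀ᶠ L in 𝓝 L₀, normalClass k L (t L) = s L

/-- Holomorphy near `L₀` of a section of the tautological bundle `R` of `LG(V)`, whose fibre at `L`
is `L` itself, as a subbundle of the trivial bundle with fibre `V`. -/
def TautHolomorphicAt (r : (L : LagGrass W) → L.1) (L₀ : LagGrass W) : Prop :=
  ContMDiffAt 𝓘(ℂ, SymSum 2 2 W) 𝓘(ℂ, SympSpace W) ω (fun L => (r L : SympSpace W)) L₀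

/-- Holomorphy near `L₀` of a section of the bundle `⨁_{i = a}^{b} Sym^i(R*)`, whose fibre at `L` is
`⨁_{i = a}^{b} Sym^i(L*)`: the values of the forms on holomorphic sections of `R` are
holomorphic. -/
def SymHolomorphicAt {a b : ℕ} (P : (L : LagGrass W) → SymSum a b L.1) (L₀ : LagGrass W) : Prop :=
  ∀ (i : Finset.Icc a b) (r : Fin (i : ℕ) → (L : LagGrass W) → L.1),
    (∀ j, TautHolomorphicAt (r j) L₀) →
      ContMDiffAt 𝓘(ℂ, SymSum 2 2 W) 𝓘(ℂ, ℂ) ω (fun L => (P L i).1 (fun j => r j L)) L₀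

/-- A linear symplectic automorphism `g` of `V` with `g(W) = L` (for a Lagrangian subspace `L`)
amounts to a splitting `V = L ⊕ L'`, where `L' = g(W*)` is Lagrangian and so is identified with
`L*`, together with linear coordinates `W ≅ L`. This is the map `W → L` given by these
coordinates. -/
def frameMap (g : Sp W) (L : LagGrass W) (hg : ∀ w : W, g.1 (w, 0) ∈ L.1) : W →L[ℂ] L.1 :=
  ((g.1 : SympSpace W →L[ℂ] SympSpace W) ∘L ContinuousLinearMap.inl ℂ W (StrongDual ℂ W)).codRestrict
    L.1 hg

/-- The parametrization by `⨁_{i = 3}^{k + 1} Sym^i(L*)` of the space of jets of Lagrangian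
submanifolds with tangent space `L`, given by the splitting `V ≅ L ⊕ L*` defined by `g`: a
polynomial `F` on `L` is sent to the jet of the graph of `dF : L → L*`. -/
def fibreParam (k : ℕ) (g : Sp W) (L : LagGrass W) (hg : ∀ w : W, g.1 (w, 0) ∈ L.1)
    (F : SymSum 3 (k + 1) L.1) : JetSpace k W :=
  (graphGerm (by norm_num) g (F.pullback (frameMap g L hg))).jet k

end Bundles

end

end LagrangianJets

open LagrangianJets

/-!
`toJet` in the charts of `LG(V)` and of `𝓛(V)` given by the same `g ∈ Sp(V)` is the inclusion of the
quadratic forms `Sym²(W*)` into `⨁_{i=2}^{k+1} Sym^i(W*)` (`toJet_grassParam`), because the jet of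
the graph of `dQ` is that of a polynomial which happens to be quadratic. Hence it is an immersion;
it is an embedding because sending a jet to its tangent space is a continuous left inverse, given in
the same charts by the projection to the quadratic part (`isSmoothEmbedding_toJet`).

The tangent space of `𝓛(V)` at a Lagrangian subspace `L = g(W)` is thus identified by `g` with
`⨁_{i=2}^{k+1} Sym^i(L*)`, in such a way that `T_L LG(V)` becomes `Sym²(L*)`, and the quotient is
`⨁_{i=3}^{k+1} Sym^i(L*)` (`normalClass_eq_iff`). The point is that this identification does not
depend on `g` (`jetDeriv_frame_independent`). Two frames of `L` differ by a linear automorphism `A`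
of `W`, which acts on polynomials by substitution, and by a symplectic map `u` which fixes `W`
pointwise, that is, `u (w, f) = (w + B f, f)`. The change of charts `τ` given by `u` fixes the
origin, and its derivative there is the identity. This is seen without computing `τ`
(`exists_transition_of_fixes`): the conformal dilation `(w, f) ↦ (w, f / 2)` of `V` acts on
polynomials as division by `2`, and it conjugates `u` to `u²`, so that `τ (τ (F / 2)) = τ F / 2`.
The derivative `D` of `τ` at `0` therefore satisfies `D² = D`, and `D = 1` because it is invertible.

Holomorphy is compared in local coordinates. Near `L₀ = g(W)`, every `L` is the graph of a quadratic
form `Q` which depends holomorphically on `L`, in the sense that `L = g (graph of dQ)`, so that `g`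
composed with the shear by `Q` is a holomorphically varying frame of `L`; since the shear translates
the chart of `g` by `Q` (`jetParam_mul_shear`), this frame gives the same coordinates on the normal
space at `L` as the derivative of the chart of `g`. The sections of the normal bundle and those of
`⨁ Sym^i(R*)` are holomorphic if and only if their coordinates are (`normalHolomorphicAt_iff`,
`symHolomorphicAt_iff`), and corresponding sections have the same coordinates.
-/

namespace LagrangianJets

noncomputable section

/-! ### Operations on symmetric forms -/

section FormOperations

variable {M N : Type*} [NormedAddCommGroup M] [NormedSpace ℂ M]
  [NormedAddCommGroup N] [NormedSpace ℂ N]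

/-- The change of the range of degrees: the components in the degrees of the target which are
missing in the source are `0`, those in the degrees missing in the target are dropped. -/
def SymSum.regrade (a b a' b' : ℕ) : SymSum a b M →L[ℂ] SymSum a' b' M :=
  ContinuousLinearMap.pi fun i =>
    if h : (i : ℕ) ∈ Finset.Icc a b then ContinuousLinearMap.proj (⟨i, h⟩ : Finset.Icc a b) else 0

theorem SymSum.regrade_apply_of_mem {a b a' b' : ℕ} (F : SymSum a b M) (i : Finset.Icc a' b')
    (h : (i : ℕ) ∈ Finset.Icc a b) : SymSum.regrade a b a' b' F i = F ⟨i, h⟩ := by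
  change (if h : (i : ℕ) ∈ Finset.Icc a b then ContinuousLinearMap.proj (⟨i, h⟩ : Finset.Icc a b)
    else 0 : SymSum a b M →L[ℂ] SymForm (i : ℕ) M) F = _
  rw [dif_pos h]
  rfl

theorem SymSum.regrade_apply_of_notMem {a b a' b' : ℕ} (F : SymSum a b M) (i : Finset.Icc a' b')
    (h : (i : ℕ) ∉ Finset.Icc a b) : SymSum.regrade a b a' b' F i = 0 := by
  change (if h : (i : ℕ) ∈ Finset.Icc a b then ContinuousLinearMap.proj (⟨i, h⟩ : Finset.Icc a b)
    else 0 : SymSum a b M →L[ℂ] SymForm (i : ℕ) M) F = _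
  rw [dif_neg h]
  rfl

theorem SymSum.eval_eq_sum_coeff {a b : ℕ} (F : SymSum a b M) (x : M) :
    F.eval x = ∑ i ∈ Finset.Icc a b, F.coeff i (fun _ => x) := by
  rw [← Finset.sum_coe_sort (Finset.Icc a b)]
  refine Finset.sum_congr rfl fun i _ => ?_
  simp [SymSum.coeff]

theorem SymSum.coeff_regrade {a b a' b' : ℕ} (h : Finset.Icc a b ⊆ Finset.Icc a' b')
    (F : SymSum a b M) (i : ℕ) : (SymSum.regrade a b a' b' F).coeff i = F.coeff i := by
  by_cases hi : i ∈ Finset.Icc a b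
  · simp only [SymSum.coeff, hi, h hi, dif_pos]
    rw [SymSum.regrade_apply_of_mem F ⟨i, h hi⟩ hi]
  · by_cases hi' : i ∈ Finset.Icc a' b'
    · simp only [SymSum.coeff, hi, hi', dif_pos]
      rw [SymSum.regrade_apply_of_notMem F ⟨i, hi'⟩ hi]
      simp
    · simp only [SymSum.coeff, hi, hi', dif_neg, not_false_iff]

theorem SymSum.eval_regrade {a b a' b' : ℕ} (h : Finset.Icc a b ⊆ Finset.Icc a' b')
    (F : SymSum a b M) : (SymSum.regrade a b a' b' F).eval = F.eval := by
  funext x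
  simp only [SymSum.eval_eq_sum_coeff, SymSum.coeff_regrade h]
  refine (Finset.sum_subset h fun i _ hi => ?_).symm
  rw [SymSum.coeff, dif_neg hi]
  rfl

theorem SymSum.eval_add {a b : ℕ} (F G : SymSum a b M) (x : M) :
    (F + G).eval x = F.eval x + G.eval x := by
  simp [SymSum.eval, Finset.sum_add_distrib]

theorem SymSum.eval_smul {a b : ℕ} (c : ℂ) (F : SymSum a b M) (x : M) :
    (c • F).eval x = c * F.eval x := by
  simp [SymSum.eval, Finset.mul_sum]

theorem SymSum.fderiv_eval_add {a b a' b' : ℕ} {F : SymSum a b M} {G : SymSum a' b' M} {x : M} :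
    fderiv ℂ (fun y => F.eval y + G.eval y) x = fderiv ℂ F.eval x + fderiv ℂ G.eval x :=
  fderiv_fun_add (F.analyticAt x).differentiableAt (G.analyticAt x).differentiableAt

theorem SymSum.fderiv_eval_smul {a b : ℕ} (c : ℂ) (F : SymSum a b M) (x : M) :
    fderiv ℂ (c • F).eval x = c • fderiv ℂ F.eval x := by
  have h : (c • F).eval = fun y => c • F.eval y := funext fun y => F.eval_smul c y
  rw [h, fderiv_fun_const_smul (F.analyticAt x).differentiableAt]

theorem SymSum.fderiv_eval_pullback {a b : ℕ} (A : M →L[ℂ] N) (F : SymSum a b N) (x : M) :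
    fderiv ℂ (F.pullback A).eval x = fderiv ℂ F.eval (A x) ∘L A :=
  ((F.analyticAt (A x)).differentiableAt.hasFDerivAt.comp x A.hasFDerivAt).fderiv

/-- Pull-back of polynomials along a linear map, as a continuous linear map. -/
def SymSum.pullbackL (a b : ℕ) (A : M →L[ℂ] N) : SymSum a b N →L[ℂ] SymSum a b M :=
  ContinuousLinearMap.pi fun i =>
    ((ContinuousMultilinearMap.compContinuousLinearMapL (F := ℂ)
      (fun _ : Fin (i : ℕ) => A) ∘L (SymForm (i : ℕ) N).subtypeL).codRestrict (SymForm (i : ℕ) M)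
        fun f => (SymForm.pullback A f).2) ∘L ContinuousLinearMap.proj i

theorem SymSum.pullback_pullback {a b : ℕ} {P : Type*} [NormedAddCommGroup P] [NormedSpace ℂ P]
    (A : M →L[ℂ] N) (B : N →L[ℂ] P) (F : SymSum a b P) :
    (F.pullback B).pullback A = F.pullback (B ∘L A) := rfl

theorem SymSum.pullback_id {a b : ℕ} (F : SymSum a b M) :
    F.pullback (ContinuousLinearMap.id ℂ M) = F := rfl

theorem SymSum.regrade_pullback {a b a' b' : ℕ} (A : M →L[ℂ] N) (F : SymSum a b N) :
    SymSum.regrade a b a' b' (F.pullback A) = (SymSum.regrade a b a' b' F).pullback A := by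
  funext i
  by_cases h : (i : ℕ) ∈ Finset.Icc a b
  · rw [SymSum.regrade_apply_of_mem _ i h]
    change _ = SymForm.pullback A (SymSum.regrade a b a' b' F i)
    rw [SymSum.regrade_apply_of_mem _ i h]
    rfl
  · rw [SymSum.regrade_apply_of_notMem _ i h]
    change _ = SymForm.pullback A (SymSum.regrade a b a' b' F i)
    rw [SymSum.regrade_apply_of_notMem _ i h]
    rfl

theorem Icc_two_subset {k : ℕ} (hk : 1 ≤ k) : Finset.Icc 2 2 ⊆ Finset.Icc 2 (k + 1) :=
  Finset.Icc_subset_Icc le_rfl (by omega)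

theorem Icc_three_subset (k : ℕ) : Finset.Icc 3 (k + 1) ⊆ Finset.Icc 2 (k + 1) :=
  Finset.Icc_subset_Icc (by norm_num) le_rfl

theorem SymSum.regrade_regrade {a b a' b' : ℕ} (h : Finset.Icc a b ⊆ Finset.Icc a' b')
    (F : SymSum a b M) : SymSum.regrade a' b' a b (SymSum.regrade a b a' b' F) = F := by
  funext i
  rw [SymSum.regrade_apply_of_mem _ i (h i.2), SymSum.regrade_apply_of_mem F ⟨i, h i.2⟩ i.2]

theorem SymSum.regrade_eq_zero {a b a' b' a'' b'' : ℕ}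
    (h : Disjoint (Finset.Icc a b) (Finset.Icc a'' b'')) (F : SymSum a b M) :
    SymSum.regrade a' b' a'' b'' (SymSum.regrade a b a' b' F) = 0 := by
  funext i
  by_cases hi : (i : ℕ) ∈ Finset.Icc a' b'
  · rw [SymSum.regrade_apply_of_mem _ i hi, SymSum.regrade_apply_of_notMem F ⟨i, hi⟩]
    · rfl
    · exact fun h' => Finset.disjoint_left.1 h h' i.2
  · rw [SymSum.regrade_apply_of_notMem _ i hi]
    rfl

theorem disjoint_Icc_two_three (k : ℕ) : Disjoint (Finset.Icc 2 2) (Finset.Icc 3 (k + 1)) :=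
  Finset.disjoint_left.2 fun i h h' => by
    have := (Finset.mem_Icc.1 h).2
    have := (Finset.mem_Icc.1 h').1
    omega

/-- A polynomial is the sum of its quadratic part and its part of degree at least `3`. -/
theorem SymSum.eq_quadratic_add_higher {k : ℕ} (F : SymSum 2 (k + 1) M) :
    F = SymSum.regrade 2 2 2 (k + 1) (SymSum.regrade 2 (k + 1) 2 2 F) +
      SymSum.regrade 3 (k + 1) 2 (k + 1) (SymSum.regrade 2 (k + 1) 3 (k + 1) F) := by
  funext i
  have hi := Finset.mem_Icc.1 i.2
  rw [Pi.add_apply]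
  rcases Nat.lt_or_ge 2 i with h | h
  · have h3 : (i : ℕ) ∈ Finset.Icc 3 (k + 1) := Finset.mem_Icc.2 ⟨h, hi.2⟩
    have h2 : (i : ℕ) ∉ Finset.Icc 2 2 := fun h' => by
      have := (Finset.mem_Icc.1 h').2
      omega
    rw [SymSum.regrade_apply_of_notMem _ i h2, SymSum.regrade_apply_of_mem _ i h3,
      SymSum.regrade_apply_of_mem _ ⟨i, h3⟩ i.2, zero_add]
  · have h3 : (i : ℕ) ∉ Finset.Icc 3 (k + 1) := fun h' => by
      have := (Finset.mem_Icc.1 h').1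
      omega
    have h2 : (i : ℕ) ∈ Finset.Icc 2 2 := Finset.mem_Icc.2 ⟨hi.1, h⟩
    rw [SymSum.regrade_apply_of_mem _ i h2, SymSum.regrade_apply_of_notMem _ i h3,
      SymSum.regrade_apply_of_mem _ ⟨i, h2⟩ i.2, add_zero]

/-- The differential of a quadratic form is linear: it is the Hessian of the form. -/
theorem SymSum.fderiv_eval_quadratic (Q : SymSum 2 2 M) (x : M) :
    fderiv ℂ Q.eval x = fderiv ℂ (fderiv ℂ Q.eval) 0 x := by
  have h2 : 2 ∈ Finset.Icc 2 2 := by simp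
  let q : ContinuousMultilinearMap ℂ (fun _ : Fin 2 => M) ℂ := (Q ⟨2, h2⟩).1
  have hq : Q.eval = fun y => q (fun _ => y) := by
    funext y
    rw [SymSum.eval_eq_sum_coeff, Finset.Icc_self, Finset.sum_singleton]
    simp [SymSum.coeff, q]
  have hd : ∀ y v, fderiv ℂ Q.eval y v = q ![v, y] + q ![y, v] := by
    intro y v
    have h1 : HasFDerivAt Q.eval (q.linearDeriv (fun _ => y) ∘L
        ContinuousLinearMap.pi fun _ => ContinuousLinearMap.id ℂ M) y := by
      rw [hq]
      exact (q.hasFDerivAt (fun _ => y)).comp y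
        (ContinuousLinearMap.pi fun _ => ContinuousLinearMap.id ℂ M).hasFDerivAt
    rw [h1.fderiv]
    change q.linearDeriv (fun _ => y) (fun _ => v) = _
    rw [ContinuousMultilinearMap.linearDeriv_apply, Fin.sum_univ_two]
    congr 2 <;> (funext i; fin_cases i <;> simp)
  have h0 : ∀ u v w : M, Function.update ![u, v] 0 w = ![w, v] := fun u v w => by
    funext i; fin_cases i <;> rfl
  have h1 : ∀ u v w : M, Function.update ![u, v] 1 w = ![u, w] := fun u v w => by
    funext i; fin_cases i <;> rfl
  have hadd1 : ∀ u u' v, q ![u + u', v] = q ![u, v] + q ![u', v] := fun u u' v => by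
    simpa only [h0] using q.map_update_add ![u, v] 0 u u'
  have hadd2 : ∀ u v v', q ![u, v + v'] = q ![u, v] + q ![u, v'] := fun u v v' => by
    simpa only [h1] using q.map_update_add ![u, v] 1 v v'
  have hsmul1 : ∀ (c : ℂ) u v, q ![c • u, v] = c • q ![u, v] := fun c u v => by
    simpa only [h0] using q.map_update_smul ![u, v] 0 c u
  have hsmul2 : ∀ (c : ℂ) u v, q ![u, c • v] = c • q ![u, v] := fun c u v => by
    simpa only [h1] using q.map_update_smul ![u, v] 1 c v
  have hlin : IsLinearMap ℂ (fderiv ℂ Q.eval) := by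
    constructor
    · intro y z
      ext v
      simp only [hd, add_apply, hadd1, hadd2]
      ring
    · intro c y
      ext v
      simp only [hd, smul_apply, hsmul1, hsmul2, smul_add]
  have hcont : Continuous (fderiv ℂ Q.eval) :=
    (Q.contDiff.fderiv_right (m := ω) le_top).continuous
  let B : M →L[ℂ] StrongDual ℂ M := ⟨hlin.mk' _, hcont⟩
  change B x = fderiv ℂ B 0 x
  rw [B.fderiv]

end FormOperations

/-! ### Symplectic maps and the relations between the charts of the jet space -/

section SymplecticMaps

variable {W : Type*} [NormedAddCommGroup W] [NormedSpace ℂ W]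

theorem symmetric_hessian {a b : ℕ} (Q : SymSum a b W) (u v : W) :
    fderiv ℂ (fderiv ℂ Q.eval) 0 u v = fderiv ℂ (fderiv ℂ Q.eval) 0 v u :=
  (Q.contDiff.contDiffAt (x := 0)).isSymmSndFDerivAt_of_omega u v

/-- The symplectic shear `(w, f) ↦ (w, f + dQ(w))` of a quadratic form `Q`, which carries the
horizontal subspace `W` to the graph of `dQ` and preserves the vertical subspace `W*`. -/
def shear (Q : SymSum 2 2 W) : Sp W :=
  ⟨ContinuousLinearEquiv.equivOfInverse
      ((ContinuousLinearMap.fst ℂ W (StrongDual ℂ W)).prod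
        (ContinuousLinearMap.snd ℂ W (StrongDual ℂ W) +
          fderiv ℂ (fderiv ℂ Q.eval) 0 ∘L ContinuousLinearMap.fst ℂ W (StrongDual ℂ W)))
      ((ContinuousLinearMap.fst ℂ W (StrongDual ℂ W)).prod
        (ContinuousLinearMap.snd ℂ W (StrongDual ℂ W) -
          fderiv ℂ (fderiv ℂ Q.eval) 0 ∘L ContinuousLinearMap.fst ℂ W (StrongDual ℂ W)))
      (fun v => Prod.ext rfl (add_sub_cancel_right _ _))
      (fun v => Prod.ext rfl (sub_add_cancel _ _)), by
    intro u v
    have := symmetric_hessian Q u.1 v.1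
    change (u.2 + fderiv ℂ (fderiv ℂ Q.eval) 0 u.1) v.1 -
      (v.2 + fderiv ℂ (fderiv ℂ Q.eval) 0 v.1) u.1 = u.2 v.1 - v.2 u.1
    simp only [add_apply, this]
    ring⟩

theorem shear_apply (Q : SymSum 2 2 W) (w : W) (f : StrongDual ℂ W) :
    (shear Q).1 (w, f) = (w, f + fderiv ℂ Q.eval w) := by
  rw [Q.fderiv_eval_quadratic]
  rfl

/-- The symplectic map `(w, f) ↦ (A w, f ∘ A⁻¹)` given by a linear automorphism `A` of `W`. -/
def levi (A : W ≃L[ℂ] W) : Sp W :=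
  ⟨A.prodCongr (A.arrowCongr (ContinuousLinearEquiv.refl ℂ ℂ)), by
    intro u v
    change u.2 (A.symm (A v.1)) - v.2 (A.symm (A u.1)) = _
    simp [omega]⟩

theorem levi_apply (A : W ≃L[ℂ] W) (w : W) (f : StrongDual ℂ W) :
    (levi A).1 (w, f) = (A w, f ∘L (A.symm : W →L[ℂ] W)) := rfl

/-- A symplectic map fixing the horizontal subspace pointwise is of the form
`(w, f) ↦ (w + B f, f)`. -/
theorem apply_of_fixes {u : Sp W} (hu : ∀ w : W, u.1 (w, 0) = (w, 0)) (w : W)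
    (f : StrongDual ℂ W) : u.1 (w, f) = (w + (u.1 (0, f)).1, f) := by
  have h1 : (u.1 (0, f)).2 = f := by
    ext v
    have h2 := u.2 (0, f) (v, 0)
    rw [hu] at h2
    simpa [omega] using h2
  have h3 : ((w, f) : SympSpace W) = (w, 0) + (0, f) := by simp
  conv_lhs => rw [h3, map_add, hu]
  exact Prod.ext rfl ((zero_add _).trans h1)

theorem mul_apply (g h : Sp W) (v : SympSpace W) : (g * h).1 v = g.1 (h.1 v) := rfl

/-- If `g` maps the horizontal subspace into a Lagrangian subspace `L`, then it maps it onto `L`. -/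
theorem symm_snd_eq_zero {g : Sp W} {L : LagGrass W} (hg : ∀ w : W, g.1 (w, 0) ∈ L.1)
    {v : SympSpace W} (hv : v ∈ L.1) : (g.1.symm v).2 = 0 := by
  ext w
  have h1 := (L.2 v).1 hv _ (hg w)
  rw [← g.1.apply_symm_apply v, g.2] at h1
  simpa [omega] using h1

theorem apply_symm_fst {g : Sp W} {L : LagGrass W} (hg : ∀ w : W, g.1 (w, 0) ∈ L.1)
    {v : SympSpace W} (hv : v ∈ L.1) : g.1 ((g.1.symm v).1, 0) = v := by
  rw [← symm_snd_eq_zero hg hv, Prod.mk.eta, g.1.apply_symm_apply]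

/-- The linear coordinates on a Lagrangian subspace given by a frame, as an equivalence. -/
def frameEquiv (g : Sp W) (L : LagGrass W) (hg : ∀ w : W, g.1 (w, 0) ∈ L.1) : W ≃L[ℂ] L.1 :=
  ContinuousLinearEquiv.equivOfInverse (frameMap g L hg)
    (ContinuousLinearMap.fst ℂ W (StrongDual ℂ W) ∘L
      (g.1.symm : SympSpace W →L[ℂ] SympSpace W) ∘L L.1.subtypeL)
    (fun w => congrArg Prod.fst (g.1.symm_apply_apply (w, 0)))
    (fun v => Subtype.ext (apply_symm_fst hg v.2))

theorem coe_frameMap (g : Sp W) (L : LagGrass W) (hg : ∀ w : W, g.1 (w, 0) ∈ L.1) (w : W) :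
    (frameMap g L hg w : SympSpace W) = g.1 (w, 0) := rfl

theorem LagGrass.exists_frame [FiniteDimensional ℂ W] (L : LagGrass W) :
    ∃ g : Sp W, ∀ w : W, g.1 (w, 0) ∈ L.1 := by
  obtain ⟨M, hM, hiso, hr⟩ := L.exists_embedding
  obtain ⟨g, hg, hgM⟩ := LagrangianJets.exists_frame M hM hiso
  refine ⟨⟨g, hg⟩, fun w => ?_⟩
  rw [← hr]
  exact ⟨w, (hgM w).symm⟩

/-- Two frames of the same Lagrangian subspace differ by a linear change of coordinates on `W`
and a symplectic map which fixes `W` pointwise. -/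
theorem exists_frame_change {g g' : Sp W} {L : LagGrass W} (hg : ∀ w : W, g.1 (w, 0) ∈ L.1)
    (hg' : ∀ w : W, g'.1 (w, 0) ∈ L.1) : ∃ (A : W ≃L[ℂ] W) (u : Sp W),
      (∀ w : W, u.1 (w, 0) = (w, 0)) ∧ g' = g * levi A * u ∧
      ∀ w, frameMap g L hg (A w) = frameMap g' L hg' w := by
  let A : W ≃L[ℂ] W := (frameEquiv g' L hg').trans (frameEquiv g L hg).symm
  have hA : ∀ w, frameMap g L hg (A w) = frameMap g' L hg' w := fun w =>
    (frameEquiv g L hg).apply_symm_apply _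
  refine ⟨A, (levi A)⁻¹ * (g⁻¹ * g'), fun w => ?_, by group, hA⟩
  have h1 : g.1 (A w, 0) = g'.1 (w, 0) := congrArg Subtype.val (hA w)
  change (levi A).1.symm (g.1.symm (g'.1 (w, 0))) = (w, 0)
  rw [← h1, g.1.symm_apply_apply, ContinuousLinearEquiv.symm_apply_eq, levi_apply,
    ContinuousLinearMap.zero_comp]

end SymplecticMaps

/-- A local map `τ` which is invertible at the fixed point `0` and whose square is conjugate to `τ`
itself under a homothety is tangent to the identity at `0`: its derivative `D` satisfies `D² = D`. -/
theorem hasFDerivAt_id_of_sq_conj {E : Type*} [NormedAddCommGroup E] [NormedSpace ℂ E]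
    {τ τ' : E → E} (hd : DifferentiableAt ℂ τ 0) (h0 : τ 0 = 0) (hd' : DifferentiableAt ℂ τ' 0)
    (hinv : ∀ᶠ x in 𝓝 0, τ' (τ x) = x)
    (hsq : ∀ᶠ x in 𝓝 0, τ (τ ((2⁻¹ : ℂ) • x)) = (2⁻¹ : ℂ) • τ x) :
    HasFDerivAt τ (ContinuousLinearMap.id ℂ E) 0 := by
  set D := fderiv ℂ τ 0
  have hτD : HasFDerivAt τ D 0 := hd.hasFDerivAt
  have hDinj : Function.Injective D := by
    have h1 : HasFDerivAt (fun x => τ' (τ x)) (fderiv ℂ τ' 0 ∘L D) 0 :=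
      HasFDerivAt.comp (0 : E) (g := τ') (by rw [h0]; exact hd'.hasFDerivAt) hτD
    have h2 := (h1.congr_of_eventuallyEq (hinv.mono fun x hx => hx.symm)).unique
      (hasFDerivAt_id 0)
    have h3 : ∀ z, fderiv ℂ τ' 0 (D z) = z := fun z => congrArg (fun T : E →L[ℂ] E => T z) h2
    exact Function.LeftInverse.injective h3
  have hDsq : ∀ x, D (D x) = D x := by
    intro x
    have hhalf : HasFDerivAt (fun x : E => (2⁻¹ : ℂ) • x)
        ((2⁻¹ : ℂ) • ContinuousLinearMap.id ℂ E) 0 := (hasFDerivAt_id 0).const_smul _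
    have h1 : HasFDerivAt (fun x => τ ((2⁻¹ : ℂ) • x))
        (D ∘L ((2⁻¹ : ℂ) • ContinuousLinearMap.id ℂ E)) 0 :=
      HasFDerivAt.comp (0 : E) (g := τ) (by rw [smul_zero]; exact hτD) hhalf
    have h2 : HasFDerivAt (fun x => τ (τ ((2⁻¹ : ℂ) • x)))
        (D ∘L (D ∘L ((2⁻¹ : ℂ) • ContinuousLinearMap.id ℂ E))) 0 :=
      HasFDerivAt.comp (0 : E) (g := τ) (by rw [smul_zero, h0]; exact hτD) h1
    have h3 := (h2.congr_of_eventuallyEq (hsq.mono fun x hx => hx.symm)).unique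
      (hτD.const_smul (2⁻¹ : ℂ))
    have h4 : D (D ((2⁻¹ : ℂ) • x)) = (2⁻¹ : ℂ) • D x :=
      congrArg (fun T : E →L[ℂ] E => T x) h3
    rw [map_smul, map_smul] at h4
    exact smul_right_injective _ (by norm_num : (2⁻¹ : ℂ) ≠ 0) h4
  have hDid : D = ContinuousLinearMap.id ℂ E := by
    ext1 x
    exact hDinj (hDsq x)
  exact hDid ▸ hτD

section JetRelations

variable {W : Type*} [NormedAddCommGroup W] [NormedSpace ℂ W]

theorem graphGerm_apply {a b : ℕ} (ha : 2 ≤ a) (g : Sp W) (F : SymSum a b W) (x : W) :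
    (graphGerm ha g F).toFun x = g.1 (x, fderiv ℂ F.eval x) := rfl

variable [FiniteDimensional ℂ W]

/-- Germs related by an exact linear change of parameters have the same jets. -/
theorem jet_eq_of_linear_reparam (k : ℕ) {φ₁ φ₂ : LagGerm W} (A : W ≃L[ℂ] W)
    (h : ∀ x, φ₂.toFun (A x) = φ₁.toFun x) : φ₁.jet k = φ₂.jet k := by
  refine LagGerm.jet_eq_iff.2 ⟨A, A.analyticAt 0, A.map_zero, ?_, ?_⟩
  · rw [A.fderiv]
    exact ContinuousLinearMap.isInvertible_equiv
  · refine (isBigO_zero (E' := SympSpace W) (fun x : W => ‖x‖ ^ (k + 1)) (𝓝 0)).congr_left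
      fun x => ?_
    rw [h, sub_self]

/-- Germs with the same jet have the same tangent space. -/
theorem tangent_eq_of_jet_eq {k : ℕ} (hk : 1 ≤ k) {φ₁ φ₂ : LagGerm W}
    (h : φ₁.jet k = φ₂.jet k) : φ₁.tangent = φ₂.tangent := by
  have key : ∀ {φ₁ φ₂ : LagGerm W}, φ₁.jet k = φ₂.jet k → φ₁.tangent.1 ≤ φ₂.tangent.1 := by
    intro φ₁ φ₂ h
    obtain ⟨ψ, hψ, hψ0, -, hO⟩ := LagGerm.jet_eq_iff.1 h
    rintro _ ⟨w, rfl⟩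
    exact ⟨fderiv ℂ ψ 0 w, contact_fderiv hk hψ hψ0 hO w⟩
  exact Subtype.ext (le_antisymm (key h) (key h.symm))

/-- A linear subspace is the tangent space at `0` of its germ. -/
theorem tangent_linearGerm (L : LagGrass W) : (linearGerm L.exists_embedding.choose
    L.exists_embedding.choose_spec.1 L.exists_embedding.choose_spec.2.1).tangent = L := by
  refine Subtype.ext ?_
  change LinearMap.range (fderiv ℂ L.exists_embedding.choose 0 : W →ₗ[ℂ] SympSpace W) = L.1
  rw [L.exists_embedding.choose.fderiv, L.exists_embedding.choose_spec.2.2]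

/-- The jet of a Lagrangian subspace is the origin of the chart given by any frame of it. -/
theorem toJet_eq_jetParam_zero (k : ℕ) {g : Sp W} {L : LagGrass W}
    (hg : ∀ w : W, g.1 (w, 0) ∈ L.1) : toJet k L = jetParam k g 0 := by
  have hM : ∀ w, L.exists_embedding.choose w ∈ L.1 := fun w =>
    L.exists_embedding.choose_spec.2.2.le ⟨w, rfl⟩
  let A : W →L[ℂ] W := ContinuousLinearMap.fst ℂ W (StrongDual ℂ W) ∘L
    (g.1.symm : SympSpace W →L[ℂ] SympSpace W) ∘L L.exists_embedding.choose
  have hA : ∀ w, g.1 (A w, 0) = L.exists_embedding.choose w := fun w => apply_symm_fst hg (hM w)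
  have hinj : Function.Injective (A : W →ₗ[ℂ] W) := fun u v huv =>
    L.exists_embedding.choose_spec.1 (by
      have huv' : A u = A v := huv
      rw [← hA, ← hA, huv'])
  refine jet_eq_of_linear_reparam k
    (LinearEquiv.ofInjectiveEndo (A : W →ₗ[ℂ] W) hinj).toContinuousLinearEquiv fun x => ?_
  have h0 : (0 : SymSum 2 (k + 1) W).eval = fun _ => 0 := funext fun x => by simp [SymSum.eval]
  rw [graphGerm_apply, h0, fderiv_fun_const]
  exact hA x

/-- A shear by `Q` translates the corresponding chart by `Q`. -/
theorem jetParam_mul_shear {k : ℕ} (hk : 1 ≤ k) (g : Sp W) (Q : SymSum 2 2 W)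
    (F : SymSum 2 (k + 1) W) :
    jetParam k (g * shear Q) F = jetParam k g (SymSum.regrade 2 2 2 (k + 1) Q + F) := by
  refine jet_eq_of_linear_reparam k (ContinuousLinearEquiv.refl ℂ W) fun x => ?_
  have h1 : (SymSum.regrade 2 2 2 (k + 1) Q + F).eval = fun y => Q.eval y + F.eval y :=
    funext fun y => by rw [SymSum.eval_add, SymSum.eval_regrade (Icc_two_subset hk)]
  rw [ContinuousLinearEquiv.refl_apply, graphGerm_apply, graphGerm_apply, mul_apply, shear_apply,
    h1, SymSum.fderiv_eval_add, add_comm]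

/-- The shear of `g` by `Q` is a frame of `g (graph of dQ)`. -/
theorem shear_frame (g : Sp W) (Q : SymSum 2 2 W) (w : W) :
    (g * shear Q).1 (w, 0) ∈ (grassParam g Q).1 := by
  refine ⟨w, ?_⟩
  have hd : HasFDerivAt (fderiv ℂ Q.eval) (fderiv ℂ (fderiv ℂ Q.eval) 0) 0 :=
    (((Q.contDiff.fderiv_right (m := ω) le_top).differentiable (by simp)) 0).hasFDerivAt
  have h1 : HasFDerivAt (graphGerm le_rfl g Q).toFun
      ((g.1 : SympSpace W →L[ℂ] SympSpace W) ∘L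
        ((ContinuousLinearMap.id ℂ W).prod (fderiv ℂ (fderiv ℂ Q.eval) 0))) 0 :=
    g.1.hasFDerivAt.comp 0 ((hasFDerivAt_id 0).prodMk hd)
  change fderiv ℂ (graphGerm le_rfl g Q).toFun 0 w = _
  rw [h1.fderiv, mul_apply, shear_apply, zero_add, Q.fderiv_eval_quadratic]
  rfl

/-- In the charts given by the same `g`, the embedding `LG(V) → 𝓛(V)` is the inclusion of the
quadratic forms. -/
theorem toJet_grassParam {k : ℕ} (hk : 1 ≤ k) (g : Sp W) (Q : SymSum 2 2 W) :
    toJet k (grassParam g Q) = jetParam k g (SymSum.regrade 2 2 2 (k + 1) Q) := by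
  rw [toJet_eq_jetParam_zero k (shear_frame g Q), jetParam_mul_shear hk, add_zero]

/-- In the charts given by the same `g`, taking the tangent space is the projection to the
quadratic part. -/
theorem tangent_graphGerm {k : ℕ} (hk : 1 ≤ k) (g : Sp W) (F : SymSum 2 (k + 1) W) :
    (graphGerm le_rfl g F).tangent = grassParam g (SymSum.regrade 2 (k + 1) 2 2 F) := by
  have hd : ∀ {a b : ℕ} (ha : 2 ≤ a) (G : SymSum a b W), fderiv ℂ (graphGerm ha g G).toFun 0 =
      (g.1 : SympSpace W →L[ℂ] SympSpace W) ∘L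
        ((ContinuousLinearMap.id ℂ W).prod (fderiv ℂ (fderiv ℂ G.eval) 0)) := fun ha G =>
    (g.1.hasFDerivAt.comp 0 ((hasFDerivAt_id 0).prodMk
      (((G.contDiff.fderiv_right (m := ω) le_top).differentiable (by simp)) 0).hasFDerivAt)).fderiv
  have hess : fderiv ℂ (fderiv ℂ F.eval) 0 =
      fderiv ℂ (fderiv ℂ (SymSum.regrade 2 (k + 1) 2 2 F).eval) 0 := by
    ext u v
    have h2 : 2 ∈ Finset.Icc 2 2 := by simp
    have h1 := F.iteratedFDeriv_eval 2 ![u, v]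
    have h3 := (SymSum.regrade 2 (k + 1) 2 2 F).iteratedFDeriv_eval 2 ![u, v]
    have h4 : (SymSum.regrade 2 (k + 1) 2 2 F).coeff 2 = F.coeff 2 := by
      rw [SymSum.coeff, dif_pos h2, SymSum.regrade_apply_of_mem _ _ (Icc_two_subset hk h2),
        SymSum.coeff, dif_pos (Icc_two_subset hk h2)]
    rw [h4, ← h1, iteratedFDeriv_two_apply, iteratedFDeriv_two_apply] at h3
    exact h3.symm
  refine Subtype.ext ?_
  change LinearMap.range (fderiv ℂ (graphGerm le_rfl g F).toFun 0 : W →ₗ[ℂ] SympSpace W) =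
    LinearMap.range (fderiv ℂ (graphGerm le_rfl g (SymSum.regrade 2 (k + 1) 2 2 F)).toFun 0 :
      W →ₗ[ℂ] SympSpace W)
  rw [hd, hd, hess]

theorem jetParam_mul_levi (k : ℕ) (g : Sp W) (A : W ≃L[ℂ] W) (F : SymSum 2 (k + 1) W) :
    jetParam k (g * levi A) F = jetParam k g (F.pullback (A.symm : W →L[ℂ] W)) := by
  refine jet_eq_of_linear_reparam k A fun x => ?_
  rw [graphGerm_apply, graphGerm_apply, mul_apply, levi_apply, SymSum.fderiv_eval_pullback]
  simp

/-- Relations between charts are preserved by the symplectic group. -/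
theorem jetParam_eq_mul_left {k : ℕ} {h h' : Sp W} {F F' : SymSum 2 (k + 1) W} (g : Sp W)
    (hF : jetParam k h F = jetParam k h' F') : jetParam k (g * h) F = jetParam k (g * h') F' := by
  obtain ⟨ψ, hψ, hψ0, hi, hO⟩ := LagGerm.jet_eq_iff.1 hF
  refine LagGerm.jet_eq_iff.2 ⟨ψ, hψ, hψ0, hi, ?_⟩
  refine (((g.1 : SympSpace W →L[ℂ] SympSpace W).isBigO_comp _ (𝓝 0)).trans hO).congr_left
    fun x => ?_
  exact map_sub g.1 _ _

/-- The conformal dilation `(w, f) ↦ (w, f / 2)` of `V` divides the polynomials by `2`, and it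
conjugates a symplectic map `u` which fixes `W` pointwise to `u²`. -/
theorem jetParam_sq_half {k : ℕ} {u : Sp W} (hu : ∀ w : W, u.1 (w, 0) = (w, 0))
    {F F' : SymSum 2 (k + 1) W} (hF : jetParam k u F = jetParam k 1 F') :
    jetParam k (u * u) ((2⁻¹ : ℂ) • F) = jetParam k 1 ((2⁻¹ : ℂ) • F') := by
  obtain ⟨ψ, hψ, hψ0, hi, hO⟩ := LagGerm.jet_eq_iff.1 hF
  refine LagGerm.jet_eq_iff.2 ⟨ψ, hψ, hψ0, hi, ?_⟩
  let c : SympSpace W →L[ℂ] SympSpace W :=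
    (ContinuousLinearMap.fst ℂ W (StrongDual ℂ W)).prod
      ((2⁻¹ : ℂ) • ContinuousLinearMap.snd ℂ W (StrongDual ℂ W))
  have hc : ∀ (w : W) (f : StrongDual ℂ W), c (w, f) = (w, (2⁻¹ : ℂ) • f) := fun _ _ => rfl
  have huc : ∀ (w : W) (f : StrongDual ℂ W), (u * u).1 (w, (2⁻¹ : ℂ) • f) = c (u.1 (w, f)) := by
    intro w f
    have h1 : u.1 (0, (2⁻¹ : ℂ) • f) = (2⁻¹ : ℂ) • u.1 (0, f) := by
      rw [← map_smul]; simp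
    rw [mul_apply, apply_of_fixes hu w, apply_of_fixes hu, h1, apply_of_fixes hu w f, hc]
    refine Prod.ext ?_ rfl
    change w + (2⁻¹ : ℂ) • (u.1 (0, f)).1 + (2⁻¹ : ℂ) • (u.1 (0, f)).1 = w + (u.1 (0, f)).1
    rw [add_assoc, ← add_smul]
    norm_num
  refine ((c.isBigO_comp _ (𝓝 0)).trans hO).congr_left fun x => ?_
  simp only [graphGerm_apply]
  rw [map_sub, SymSum.fderiv_eval_smul, SymSum.fderiv_eval_smul, huc]
  rfl

theorem jetParam_zero_of_fixes (k : ℕ) {u : Sp W} (hu : ∀ w : W, u.1 (w, 0) = (w, 0)) :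
    jetParam k u 0 = jetParam k 1 0 := by
  refine jet_eq_of_linear_reparam k (ContinuousLinearEquiv.refl ℂ W) fun x => ?_
  have h0 : (0 : SymSum 2 (k + 1) W).eval = fun _ => 0 := funext fun x => by simp [SymSum.eval]
  simp only [graphGerm_apply, h0, fderiv_fun_const, ContinuousLinearEquiv.refl_apply]
  exact (hu x).symm

/-- The change between the charts of two frames which agree on `W` is tangent to the identity at
the origin. Indeed, if `D` is its derivative there, then the derivative for the square of the
change of frames is `D²`; but this square is conjugate to the change of frames itself under a
dilation, so `D² = D`. -/
theorem exists_transition_of_fixes (k : ℕ) {u : Sp W} (hu : ∀ w : W, u.1 (w, 0) = (w, 0)) :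
    ∃ τ : SymSum 2 (k + 1) W → SymSum 2 (k + 1) W,
      HasFDerivAt τ (ContinuousLinearMap.id ℂ (SymSum 2 (k + 1) W)) 0 ∧ τ 0 = 0 ∧
      ∀ᶠ F in 𝓝 0, ∀ g : Sp W, jetParam k (g * u) F = jetParam k g (τ F) := by
  have hu' : ∀ w : W, (u⁻¹).1 (w, 0) = (w, 0) := fun w => by
    change u.1.symm (w, 0) = (w, 0)
    rw [ContinuousLinearEquiv.symm_apply_eq, hu]
  have trans : ∀ {u : Sp W}, (∀ w : W, u.1 (w, 0) = (w, 0)) →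
      ∃ τ : SymSum 2 (k + 1) W → SymSum 2 (k + 1) W, DifferentiableAt ℂ τ 0 ∧ τ 0 = 0 ∧
        ∀ᶠ F in 𝓝 0, ∀ g : Sp W, jetParam k (g * u) F = jetParam k g (τ F) := by
    intro u hu
    obtain ⟨τ, hτ, h⟩ := jetParam_transition u 1 (0 : SymSum 2 (k + 1) W)
      ⟨0, (jetParam_zero_of_fixes k hu).symm⟩
    refine ⟨τ, hτ.differentiableAt (by simp), ?_, h.mono fun F hF g => ?_⟩
    · exact jetParam_injective k 1 (h.self_of_nhds.symm.trans (jetParam_zero_of_fixes k hu))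
    · simpa using jetParam_eq_mul_left g hF
  obtain ⟨τ, hd, h0, hτ⟩ := trans hu
  obtain ⟨τ', hd', h0', hτ'⟩ := trans hu'
  have ht : Tendsto τ (𝓝 0) (𝓝 0) := by
    have := hd.continuousAt.tendsto
    rwa [h0] at this
  refine ⟨τ, hasFDerivAt_id_of_sq_conj (E := SymSum 2 (k + 1) W) hd h0 hd' ?_ ?_, h0, hτ⟩
  · filter_upwards [hτ, ht.eventually hτ'] with F h1 h2
    have h3 := h1 u⁻¹
    have h4 := h2 1
    rw [inv_mul_cancel] at h3
    rw [one_mul] at h4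
    exact jetParam_injective k 1 (h4.symm.trans h3.symm)
  · have hhalf : Tendsto (fun F : SymSum 2 (k + 1) W => (2⁻¹ : ℂ) • F) (𝓝 0) (𝓝 0) := by
      have := ((2⁻¹ : ℂ) • ContinuousLinearMap.id ℂ (SymSum 2 (k + 1) W)).continuous.tendsto 0
      rwa [map_zero] at this
    filter_upwards [hτ, hhalf.eventually hτ, hhalf.eventually (ht.eventually hτ)] with F h1 h2 h3
    have h4 := h1 1
    rw [one_mul] at h4
    have h5 := h3 1
    rw [one_mul] at h5
    refine jetParam_injective k 1 ?_
    rw [← h5, ← h2 u, jetParam_sq_half hu h4]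

end JetRelations

/-! ### Charts, and the embedding of the Lagrangian Grassmannian -/

section ChartDerivatives

theorem continuousAt_of_comp_symm {X Y Z : Type*} [TopologicalSpace X] [TopologicalSpace Y]
    [TopologicalSpace Z] {e : OpenPartialHomeomorph X Y} {f : X → Z} {y : Y} (hy : y ∈ e.target)
    (h : ContinuousAt (f ∘ e.symm) y) : ContinuousAt f (e.symm y) := by
  rw [e.symm.continuousAt_iff_continuousAt_comp_right (e.map_target hy)]
  simpa [e.right_inv hy] using h

variable {E M : Type*} [NormedAddCommGroup E] [NormedSpace ℂ E] [TopologicalSpace M]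
  [ChartedSpace E M] [IsManifold 𝓘(ℂ, E) ω M] {e : OpenPartialHomeomorph M E}

theorem contMDiff_symm_of_mem_atlas (he : e ∈ atlas E M) (ht : e.target = Set.univ) :
    ContMDiff 𝓘(ℂ, E) 𝓘(ℂ, E) ω e.symm := by
  have h := contMDiffOn_symm_of_mem_maximalAtlas (I := 𝓘(ℂ, E)) (n := ω)
    (IsManifold.subset_maximalAtlas he)
  rwa [ht, contMDiffOn_univ] at h

variable {E' N : Type*} [NormedAddCommGroup E'] [NormedSpace ℂ E'] [TopologicalSpace N]
  [ChartedSpace E' N]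

/-- The coordinates in a chart of a holomorphic family of tangent vectors are holomorphic. -/
theorem contMDiffAt_mfderiv_chart (he : e ∈ atlas E M) {x : N → M}
    {v : (y : N) → TangentSpace 𝓘(ℂ, E) (x y)} {y₀ : N} (hy₀ : x y₀ ∈ e.source)
    (hv : ContMDiffAt 𝓘(ℂ, E') 𝓘(ℂ, E).tangent ω
      (fun y => (⟨x y, v y⟩ : TangentBundle 𝓘(ℂ, E) M)) y₀) :
    ContMDiffAt 𝓘(ℂ, E') 𝓘(ℂ, E) ω
      (fun y => (mfderiv 𝓘(ℂ, E) 𝓘(ℂ, E) e (x y) (v y) : E)) y₀ := by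
  have hopen : IsOpen (Bundle.TotalSpace.proj ⁻¹' e.source : Set (TangentBundle 𝓘(ℂ, E) M)) :=
    e.open_source.preimage (FiberBundle.continuous_proj E _)
  have h1 := (contMDiffOn_of_mem_maximalAtlas (I := 𝓘(ℂ, E)) (n := ω)
    (IsManifold.subset_maximalAtlas he)).contMDiffOn_tangentMapWithin (m := ω) le_rfl
      e.open_source.uniqueMDiffOn
  have h2 : ContMDiffOn 𝓘(ℂ, E).tangent 𝓘(ℂ, E).tangent ω (tangentMap 𝓘(ℂ, E) 𝓘(ℂ, E) e)
      (Bundle.TotalSpace.proj ⁻¹' e.source : Set (TangentBundle 𝓘(ℂ, E) M)) :=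
    h1.congr fun p hp => (tangentMapWithin_eq_tangentMap
      (e.open_source.uniqueMDiffOn p.1 hp) (mdifferentiableAt_atlas he hp)).symm
  have h3 := (h2.contMDiffAt (x := ⟨x y₀, v y₀⟩) (hopen.mem_nhds hy₀)).comp y₀ hv
  exact (contMDiff_snd_tangentBundle_modelSpace E 𝓘(ℂ, E)).contMDiffAt.comp y₀ h3

/-- A family of tangent vectors with holomorphic coordinates in a chart is holomorphic. -/
theorem contMDiffAt_mfderiv_symm_chart (he : e ∈ atlas E M) (ht : e.target = Set.univ)
    {a X : N → E} {y₀ : N} (ha : ContMDiffAt 𝓘(ℂ, E') 𝓘(ℂ, E) ω a y₀)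
    (hX : ContMDiffAt 𝓘(ℂ, E') 𝓘(ℂ, E) ω X y₀) :
    ContMDiffAt 𝓘(ℂ, E') 𝓘(ℂ, E).tangent ω
      (fun y => (⟨e.symm (a y), mfderiv 𝓘(ℂ, E) 𝓘(ℂ, E) e.symm (a y) (X y)⟩ :
        TangentBundle 𝓘(ℂ, E) M)) y₀ := by
  have h1 := (contMDiff_symm_of_mem_atlas he ht).contMDiff_tangentMap (m := ω) le_rfl
  have h2 : ContMDiffAt 𝓘(ℂ, E') 𝓘(ℂ, E).tangent ω
      (fun y => (⟨a y, X y⟩ : TangentBundle 𝓘(ℂ, E) E)) y₀ := by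
    refine Bundle.contMDiffAt_totalSpace.2 ⟨ha, ?_⟩
    convert! hX with y
    simp
  exact h1.contMDiffAt.comp y₀ h2

theorem mfderiv_symm_bijective (he : e ∈ atlas E M) {y : E} (hy : y ∈ e.target) :
    Function.Bijective (mfderiv 𝓘(ℂ, E) 𝓘(ℂ, E) e.symm y) :=
  (mdifferentiable_of_mem_atlas he).symm.mfderiv_bijective hy

end ChartDerivatives

section Charts

variable {W : Type*} [NormedAddCommGroup W] [NormedSpace ℂ W] [FiniteDimensional ℂ W]

/-- The chart of `𝓛(V)` inverse to `jetParam k g`. -/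
def jetChart (k : ℕ) (g : Sp W) : OpenPartialHomeomorph (JetSpace k W) (SymSum 2 (k + 1) W) :=
  (jetParam_holParam k W).core.openPartialHomeomorph ((jetParam_holParam k W).chart g) ⟨g, rfl⟩

theorem jetChart_mem_atlas (k : ℕ) (g : Sp W) :
    jetChart k g ∈ atlas (SymSum 2 (k + 1) W) (JetSpace k W) := by
  change jetChart k g ∈ ⋃ (f) (hf : f ∈ (jetParam_holParam k W).core.atlas),
    {(jetParam_holParam k W).core.openPartialHomeomorph f hf}
  simp only [Set.mem_iUnion, Set.mem_singleton_iff]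
  exact ⟨_, ⟨g, rfl⟩, rfl⟩

theorem jetChart_jetParam (k : ℕ) (g : Sp W) (F : SymSum 2 (k + 1) W) :
    jetChart k g (jetParam k g F) = F := (jetChart k g).right_inv trivial

/-- The chart of `LG(V)` inverse to `grassParam g`. -/
def grassChart (g : Sp W) : OpenPartialHomeomorph (LagGrass W) (SymSum 2 2 W) :=
  (grassParam_holParam W).core.openPartialHomeomorph ((grassParam_holParam W).chart g) ⟨g, rfl⟩

theorem grassChart_mem_atlas (g : Sp W) : grassChart g ∈ atlas (SymSum 2 2 W) (LagGrass W) := by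
  change grassChart g ∈ ⋃ (f) (hf : f ∈ (grassParam_holParam W).core.atlas),
    {(grassParam_holParam W).core.openPartialHomeomorph f hf}
  simp only [Set.mem_iUnion, Set.mem_singleton_iff]
  exact ⟨_, ⟨g, rfl⟩, rfl⟩

theorem contMDiff_jetParam (k : ℕ) (g : Sp W) :
    ContMDiff 𝓘(ℂ, SymSum 2 (k + 1) W) 𝓘(ℂ, SymSum 2 (k + 1) W) ω (jetParam k g) :=
  contMDiff_symm_of_mem_atlas (jetChart_mem_atlas k g) rfl

theorem contMDiff_grassParam (g : Sp W) :
    ContMDiff 𝓘(ℂ, SymSum 2 2 W) 𝓘(ℂ, SymSum 2 2 W) ω (grassParam g) :=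
  contMDiff_symm_of_mem_atlas (grassChart_mem_atlas g) rfl

/-- A Lagrangian subspace is the origin of the chart given by any frame of it. -/
theorem grassParam_zero {g : Sp W} {L : LagGrass W} (hg : ∀ w : W, g.1 (w, 0) ∈ L.1) :
    grassParam g 0 = L := by
  have h0 : ∀ w : W, g.1 (w, 0) ∈ (grassParam g 0).1 := fun w => by
    have h := shear_frame g 0 w
    have hz : (0 : SymSum 2 2 W).eval = fun _ => 0 := funext fun x => by simp [SymSum.eval]
    rwa [mul_apply, shear_apply, hz, fderiv_fun_const, Pi.zero_apply, add_zero] at h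
  refine Subtype.ext (le_antisymm (fun v hv => ?_) fun v hv => ?_)
  · rw [← apply_symm_fst h0 hv]
    exact hg _
  · rw [← apply_symm_fst hg hv]
    exact h0 _

end Charts

section Embedding

variable {W : Type*} [NormedAddCommGroup W] [NormedSpace ℂ W] [FiniteDimensional ℂ W]

/-- The map `𝓛(V) → LG(V)` which sends the jet of a submanifold to its tangent space. -/
def JetSpace.tangent {k : ℕ} (hk : 1 ≤ k) (j : JetSpace k W) : LagGrass W :=
  Quotient.lift LagGerm.tangent
    (fun _ _ h => tangent_eq_of_jet_eq hk (LagGerm.jet_eq_iff.2 h)) j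

theorem JetSpace.tangent_toJet {k : ℕ} (hk : 1 ≤ k) (L : LagGrass W) :
    JetSpace.tangent hk (toJet k L) = L :=
  tangent_linearGerm L

theorem JetSpace.tangent_jetParam {k : ℕ} (hk : 1 ≤ k) (g : Sp W) (F : SymSum 2 (k + 1) W) :
    JetSpace.tangent hk (jetParam k g F) = grassParam g (SymSum.regrade 2 (k + 1) 2 2 F) :=
  tangent_graphGerm hk g F

theorem JetSpace.continuous_tangent {k : ℕ} (hk : 1 ≤ k) :
    Continuous (JetSpace.tangent hk : JetSpace k W → LagGrass W) := by
  refine continuous_iff_continuousAt.2 fun j => ?_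
  obtain ⟨g, F, rfl⟩ := jetParam_surj k j
  refine continuousAt_of_comp_symm (e := jetChart k g) trivial ?_
  have h : JetSpace.tangent hk ∘ (jetChart k g).symm =
      grassParam g ∘ SymSum.regrade 2 (k + 1) 2 2 := funext (JetSpace.tangent_jetParam hk g)
  rw [h]
  exact ((contMDiff_grassParam g).continuous.comp
    (SymSum.regrade 2 (k + 1) 2 2).continuous).continuousAt

instance (a b : ℕ) (M : Type*) [NormedAddCommGroup M] [NormedSpace ℂ M] :
    ContinuousAdd (SymSum a b M) :=
  (inferInstance : IsTopologicalAddGroup (SymSum a b M)).toContinuousAdd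

/-- Polynomials without terms of degree at most `1` are sums of a quadratic form and a polynomial
without terms of degree at most `2`. -/
def quadraticSplit (k : ℕ) (hk : 1 ≤ k) (W : Type*) [NormedAddCommGroup W] [NormedSpace ℂ W] :
    (SymSum 2 2 W × SymSum 3 (k + 1) W) ≃L[ℂ] SymSum 2 (k + 1) W :=
  ContinuousLinearEquiv.equivOfInverse
    ((SymSum.regrade 2 2 2 (k + 1)).coprod (SymSum.regrade 3 (k + 1) 2 (k + 1)))
    ((SymSum.regrade 2 (k + 1) 2 2).prod (SymSum.regrade 2 (k + 1) 3 (k + 1)))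
    (fun p => by
      refine Prod.ext ?_ ?_
      · change SymSum.regrade 2 (k + 1) 2 2 (SymSum.regrade 2 2 2 (k + 1) p.1 +
          SymSum.regrade 3 (k + 1) 2 (k + 1) p.2) = p.1
        rw [map_add, SymSum.regrade_regrade (Icc_two_subset hk),
          SymSum.regrade_eq_zero (disjoint_Icc_two_three k).symm, add_zero]
      · change SymSum.regrade 2 (k + 1) 3 (k + 1) (SymSum.regrade 2 2 2 (k + 1) p.1 +
          SymSum.regrade 3 (k + 1) 2 (k + 1) p.2) = p.2
        rw [map_add, SymSum.regrade_regrade (Icc_three_subset k),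
          SymSum.regrade_eq_zero (disjoint_Icc_two_three k), zero_add])
    (fun F => F.eq_quadratic_add_higher.symm)

theorem continuous_toJet {k : ℕ} (hk : 1 ≤ k) :
    Continuous (toJet k : LagGrass W → JetSpace k W) := by
  refine continuous_iff_continuousAt.2 fun L => ?_
  obtain ⟨g, hg⟩ := L.exists_frame
  rw [← grassParam_zero hg]
  refine continuousAt_of_comp_symm (e := grassChart g) trivial ?_
  have h : toJet k ∘ (grassChart g).symm = jetParam k g ∘ SymSum.regrade 2 2 2 (k + 1) :=
    funext (toJet_grassParam hk g)
  rw [h]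
  exact ((contMDiff_jetParam k g).continuous.comp
    (SymSum.regrade 2 2 2 (k + 1)).continuous).continuousAt

/-- In suitable charts, `LG(V) → 𝓛(V)` is the inclusion of the quadratic forms, and it has the
continuous left inverse which sends a jet to its tangent space. -/
theorem isSmoothEmbedding_toJet {k : ℕ} (hk : 1 ≤ k) :
    Manifold.IsSmoothEmbedding 𝓘(ℂ, SymSum 2 2 W) 𝓘(ℂ, SymSum 2 (k + 1) W) ω
      (toJet k : LagGrass W → JetSpace k W) := by
  refine ⟨Manifold.IsImmersionOfComplement.isImmersion (F := SymSum 3 (k + 1) W) fun L => ?_,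
    Topology.IsEmbedding.of_leftInverse (JetSpace.tangent_toJet hk)
      (JetSpace.continuous_tangent hk) (continuous_toJet hk)⟩
  obtain ⟨g, hg⟩ := L.exists_frame
  refine Manifold.IsImmersionAtOfComplement.mk_of_charts (quadraticSplit k hk W) (grassChart g)
    (jetChart k g) ⟨0, grassParam_zero hg⟩ ⟨0, (toJet_eq_jetParam_zero k hg).symm⟩
    (IsManifold.subset_maximalAtlas (grassChart_mem_atlas g))
    (IsManifold.subset_maximalAtlas (jetChart_mem_atlas k g)) ?_ ?_
  · rintro _ ⟨Q, rfl⟩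
    exact ⟨_, (toJet_grassParam hk g Q).symm⟩
  · intro Q _
    change jetChart k g (toJet k (grassParam g Q)) =
      SymSum.regrade 2 2 2 (k + 1) Q + SymSum.regrade 3 (k + 1) 2 (k + 1) 0
    rw [toJet_grassParam hk, jetChart_jetParam, map_zero, add_zero]

end Embedding

/-! ### The normal spaces -/

theorem quotient_mk_eq_iff {U V : Type*} [AddCommGroup U] [Module ℂ U] [AddCommGroup V]
    [Module ℂ V] (f : U →ₗ[ℂ] V) (a b : V) :
    (Submodule.Quotient.mk a : V ⧸ LinearMap.range f) = Submodule.Quotient.mk b ↔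
      ∃ u, f u + b = a := by
  rw [Submodule.Quotient.eq, LinearMap.mem_range]
  exact exists_congr fun u => eq_sub_iff_add_eq

section DerivativesOfParametrizations

variable {E₁ E M : Type*} [NormedAddCommGroup E₁] [NormedSpace ℂ E₁] [NormedAddCommGroup E]
  [NormedSpace ℂ E] [TopologicalSpace M] [ChartedSpace E M]

/-- The chain rule for a local factorization `f = p ∘ τ` through a parametrization `p` of `M`. -/
theorem mfderiv_of_eventually_eq_comp {f : E₁ → M} {p : E → M} {τ : E₁ → E} {T : E₁ →L[ℂ] E}
    {x : E₁} {y : E} (hτ : HasFDerivAt τ T x) (hy : τ x = y)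
    (hp : MDifferentiableAt 𝓘(ℂ, E) 𝓘(ℂ, E) p y) (h : ∀ᶠ z in 𝓝 x, f z = p (τ z)) (v : E₁) :
    (mfderiv 𝓘(ℂ, E₁) 𝓘(ℂ, E) f x v : E) = mfderiv 𝓘(ℂ, E) 𝓘(ℂ, E) p y (T v) := by
  subst hy
  have h1 := hp.hasMFDerivAt.comp x hτ.hasMFDerivAt
  have h2 := (h1.congr_of_eventuallyEq h).mfderiv
  rw [h2]
  rfl

/-- The linear map is a bare function `T` here, so that the algebraic structure of its source is that
induced by the norm, also for the spaces `SymSum a b W`. -/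
theorem mfderiv_of_eq_comp_linear [FiniteDimensional ℂ E₁] {f : E₁ → M} {p : E → M}
    {T : E₁ → E} (hT : IsLinearMap ℂ T) (hp : MDifferentiableAt 𝓘(ℂ, E) 𝓘(ℂ, E) p 0)
    (h : ∀ z, f z = p (T z)) (v : E₁) :
    (mfderiv 𝓘(ℂ, E₁) 𝓘(ℂ, E) f 0 v : E) = mfderiv 𝓘(ℂ, E) 𝓘(ℂ, E) p 0 (T v) :=
  mfderiv_of_eventually_eq_comp (LinearMap.toContinuousLinearMap (hT.mk' T)).hasFDerivAt
    hT.map_zero hp (Eventually.of_forall h) v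

theorem mfderiv_of_eq_comp_translation {f p : E → M} {y : E}
    (hp : MDifferentiableAt 𝓘(ℂ, E) 𝓘(ℂ, E) p y) (h : ∀ z, f z = p (y + z)) (v : E) :
    (mfderiv 𝓘(ℂ, E) 𝓘(ℂ, E) f 0 v : E) = mfderiv 𝓘(ℂ, E) 𝓘(ℂ, E) p y v :=
  mfderiv_of_eventually_eq_comp ((hasFDerivAt_id (0 : E)).const_add y) (add_zero y) hp
    (Eventually.of_forall h) v

/-- The image of the derivative of a map which is given by the linear map `T` in terms of a
parametrization `γ` of its source and a parametrization `p` of its target. -/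
theorem mem_range_mfderiv_of_comp_eq [FiniteDimensional ℂ E₁] {G : Type*} [TopologicalSpace G]
    [ChartedSpace E₁ G] {f : G → M} {γ : E₁ → G} {p : E → M} {T : E₁ → E}
    (hT : IsLinearMap ℂ T)
    (hf : MDifferentiableAt 𝓘(ℂ, E₁) 𝓘(ℂ, E) f (γ 0))
    (hγ : MDifferentiableAt 𝓘(ℂ, E₁) 𝓘(ℂ, E₁) γ 0)
    (hγs : Function.Surjective (mfderiv 𝓘(ℂ, E₁) 𝓘(ℂ, E₁) γ 0))
    (hp : MDifferentiableAt 𝓘(ℂ, E) 𝓘(ℂ, E) p 0) (h : ∀ z, f (γ z) = p (T z)) (v : E) :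
    (∃ q, mfderiv 𝓘(ℂ, E₁) 𝓘(ℂ, E) f (γ 0) q = v) ↔
      ∃ Q, mfderiv 𝓘(ℂ, E) 𝓘(ℂ, E) p 0 (T Q) = v := by
  have h1 : ∀ Q : E₁, (mfderiv 𝓘(ℂ, E₁) 𝓘(ℂ, E) f (γ 0)
      (mfderiv 𝓘(ℂ, E₁) 𝓘(ℂ, E₁) γ 0 Q) : E) = mfderiv 𝓘(ℂ, E) 𝓘(ℂ, E) p 0 (T Q) := fun Q => by
    rw [← mfderiv_of_eq_comp_linear (f := f ∘ γ) hT hp h, mfderiv_comp (0 : E₁) hf hγ]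
    rfl
  constructor
  · rintro ⟨q, rfl⟩
    obtain ⟨Q, rfl⟩ := hγs q
    exact ⟨Q, (h1 Q).symm⟩
  · rintro ⟨Q, rfl⟩
    exact ⟨_, h1 Q⟩

theorem tangentBundle_mk_congr {x y : M} (h : x = y) (v : E) :
    (⟨x, v⟩ : TangentBundle 𝓘(ℂ, E) M) = ⟨y, v⟩ := by
  subst h
  rfl

theorem tangentMap_of_eq_comp_linear [FiniteDimensional ℂ E₁] {f : E₁ → M} {p : E → M}
    {T : E₁ → E} {y : M} (hT : IsLinearMap ℂ T) (hp : MDifferentiableAt 𝓘(ℂ, E) 𝓘(ℂ, E) p 0)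
    (h : ∀ z, f z = p (T z)) (hy : f 0 = y) (v : E₁) :
    tangentMap 𝓘(ℂ, E₁) 𝓘(ℂ, E) f ⟨0, v⟩ =
      (⟨y, mfderiv 𝓘(ℂ, E) 𝓘(ℂ, E) p 0 (T v)⟩ : TangentBundle 𝓘(ℂ, E) M) := by
  subst hy
  exact congrArg (fun w : E => (⟨f 0, w⟩ : TangentBundle 𝓘(ℂ, E) M))
    (mfderiv_of_eq_comp_linear hT hp h v)

end DerivativesOfParametrizations

instance (i : ℕ) (M : Type*) [NormedAddCommGroup M] [NormedSpace ℂ M] [FiniteDimensional ℂ M] :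
    FiniteDimensional ℂ (SymForm i M) :=
  have := finiteDimensional_multilinear (W := M) i
  FiniteDimensional.finiteDimensional_submodule (SymForm i M)

/-- Polynomials with the same terms of degree at least `3` differ by a quadratic form. -/
theorem exists_quadratic_add_eq {W : Type*} [NormedAddCommGroup W] [NormedSpace ℂ W] {k : ℕ}
    (hk : 1 ≤ k) {X Y : SymSum 2 (k + 1) W}
    (h : SymSum.regrade 2 (k + 1) 3 (k + 1) X = SymSum.regrade 2 (k + 1) 3 (k + 1) Y) :
    ∃ Q : SymSum 2 2 W, SymSum.regrade 2 2 2 (k + 1) Q + Y = X := by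
  refine ⟨fun i => X ⟨i, Icc_two_subset hk i.2⟩ - Y ⟨i, Icc_two_subset hk i.2⟩, ?_⟩
  funext i
  rw [Pi.add_apply]
  by_cases h2 : (i : ℕ) ∈ Finset.Icc 2 2
  · rw [SymSum.regrade_apply_of_mem _ i h2]
    exact sub_add_cancel (X i) (Y i)
  · have h3 : (i : ℕ) ∈ Finset.Icc 3 (k + 1) := by
      have := Finset.mem_Icc.1 i.2
      simp only [Finset.mem_Icc] at h2 ⊢
      omega
    have h4 := congrFun h ⟨i, h3⟩
    rw [SymSum.regrade_apply_of_mem X ⟨i, h3⟩ i.2, SymSum.regrade_apply_of_mem Y ⟨i, h3⟩ i.2] at h4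
    rw [SymSum.regrade_apply_of_notMem _ i h2, zero_add]
    exact h4.symm

section TangentSpaces

variable {W : Type*} [NormedAddCommGroup W] [NormedSpace ℂ W] [FiniteDimensional ℂ W]

/-- The derivative at `F` of the parametrization `jetParam k g`. All tangent spaces of `𝓛(V)` are
by definition copies of the model space. -/
def jetDeriv (k : ℕ) (g : Sp W) (F : SymSum 2 (k + 1) W) :
    SymSum 2 (k + 1) W →L[ℂ] SymSum 2 (k + 1) W :=
  mfderiv 𝓘(ℂ, SymSum 2 (k + 1) W) 𝓘(ℂ, SymSum 2 (k + 1) W) (jetParam k g) F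

theorem mdifferentiableAt_jetParam (k : ℕ) (g : Sp W) (F : SymSum 2 (k + 1) W) :
    MDifferentiableAt 𝓘(ℂ, SymSum 2 (k + 1) W) 𝓘(ℂ, SymSum 2 (k + 1) W) (jetParam k g) F :=
  (contMDiff_jetParam k g).mdifferentiable (by simp) F

theorem jetDeriv_bijective (k : ℕ) (g : Sp W) (F : SymSum 2 (k + 1) W) :
    Function.Bijective (jetDeriv k g F) :=
  mfderiv_symm_bijective (jetChart_mem_atlas k g) trivial

/-- The frame given by a shear of `g` induces on the tangent space the coordinates of the chart of
`g`, since the two charts differ by a translation. -/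
theorem jetDeriv_mul_shear {k : ℕ} (hk : 1 ≤ k) (g : Sp W) (Q : SymSum 2 2 W)
    (X : SymSum 2 (k + 1) W) : jetDeriv k (g * shear Q) 0 X =
      jetDeriv k g (SymSum.regrade 2 2 2 (k + 1) Q) X :=
  mfderiv_of_eq_comp_translation (E := SymSum 2 (k + 1) W) (mdifferentiableAt_jetParam k g _)
    (jetParam_mul_shear hk g Q) X

/-- A linear change of coordinates on `W` acts on tangent vectors by substitution. -/
theorem jetDeriv_mul_levi (k : ℕ) (g : Sp W) (A : W ≃L[ℂ] W) (X : SymSum 2 (k + 1) W) :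
    jetDeriv k (g * levi A) 0 X = jetDeriv k g 0 (X.pullback (A.symm : W →L[ℂ] W)) :=
  mfderiv_of_eq_comp_linear (E₁ := SymSum 2 (k + 1) W) (E := SymSum 2 (k + 1) W)
    ⟨fun _ _ => rfl, fun _ _ => rfl⟩ (mdifferentiableAt_jetParam k g 0) (jetParam_mul_levi k g A) X

theorem jetDeriv_mul_of_fixes (k : ℕ) (g : Sp W) {u : Sp W} (hu : ∀ w : W, u.1 (w, 0) = (w, 0))
    (X : SymSum 2 (k + 1) W) : jetDeriv k (g * u) 0 X = jetDeriv k g 0 X := by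
  obtain ⟨τ, hτ, hτ0, h⟩ := exists_transition_of_fixes k hu
  exact mfderiv_of_eventually_eq_comp (E₁ := SymSum 2 (k + 1) W) (E := SymSum 2 (k + 1) W)
    hτ hτ0 (mdifferentiableAt_jetParam k g 0) (h.mono fun F hF => hF g) X

/-- The tangent vectors at `L ∈ LG(V)` of the graphs of the differentials of polynomials on `L` do
not depend on the splitting of `V`. -/
theorem jetDeriv_frame_independent (k : ℕ) {g g' : Sp W} {L : LagGrass W}
    (hg : ∀ w : W, g.1 (w, 0) ∈ L.1) (hg' : ∀ w : W, g'.1 (w, 0) ∈ L.1)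
    (F : SymSum 2 (k + 1) L.1) :
    jetDeriv k g' 0 (F.pullback (frameMap g' L hg')) =
      jetDeriv k g 0 (F.pullback (frameMap g L hg)) := by
  obtain ⟨A, u, hu, rfl, hA⟩ := exists_frame_change hg hg'
  rw [jetDeriv_mul_of_fixes k _ hu, jetDeriv_mul_levi]
  have h : (frameMap (g * levi A * u) L hg') ∘L (A.symm : W →L[ℂ] W) = frameMap g L hg := by
    ext1 w
    change frameMap (g * levi A * u) L hg' (A.symm w) = _
    rw [← hA, A.apply_symm_apply]
  rw [← h]
  rfl

/-- The tangent space of `LG(V)` inside that of `𝓛(V)` is the space of quadratic forms. -/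
theorem mem_range_mfderiv_toJet {k : ℕ} (hk : 1 ≤ k) {g : Sp W} {L : LagGrass W}
    (hg : ∀ w : W, g.1 (w, 0) ∈ L.1) (v : SymSum 2 (k + 1) W) :
    (∃ q, mfderiv 𝓘(ℂ, SymSum 2 2 W) 𝓘(ℂ, SymSum 2 (k + 1) W) (toJet k) L q = v) ↔
      ∃ Q, jetDeriv k g 0 (SymSum.regrade 2 2 2 (k + 1) Q) = v := by
  obtain rfl := grassParam_zero hg
  have h1 : MDifferentiableAt 𝓘(ℂ, SymSum 2 2 W) 𝓘(ℂ, SymSum 2 (k + 1) W) (toJet k)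
      (grassParam g 0) :=
    (isSmoothEmbedding_toJet (W := W) hk).contMDiff.mdifferentiable (by simp) _
  have h2 : MDifferentiableAt 𝓘(ℂ, SymSum 2 2 W) 𝓘(ℂ, SymSum 2 2 W) (grassParam g) 0 :=
    (contMDiff_grassParam g).mdifferentiable (by simp) 0
  have h3 : Function.Surjective
      (mfderiv 𝓘(ℂ, SymSum 2 2 W) 𝓘(ℂ, SymSum 2 2 W) (grassParam g) 0) :=
    (mfderiv_symm_bijective (grassChart_mem_atlas g) (y := 0) trivial).2
  exact mem_range_mfderiv_of_comp_eq (E₁ := SymSum 2 2 W) (E := SymSum 2 (k + 1) W)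
    ⟨fun x y => map_add (SymSum.regrade 2 2 2 (k + 1)) x y,
      fun c x => map_smul (SymSum.regrade 2 2 2 (k + 1)) c x⟩
    h1 h2 h3 (mdifferentiableAt_jetParam k g 0) (toJet_grassParam hk g) v

/-- Two tangent vectors of `𝓛(V)` at `L` have the same normal class if and only if their coordinates
have the same terms of degree at least `3`. -/
theorem normalClass_eq_iff {k : ℕ} (hk : 1 ≤ k) {g : Sp W} {L : LagGrass W}
    (hg : ∀ w : W, g.1 (w, 0) ∈ L.1) (X Y : SymSum 2 (k + 1) W) :
    normalClass k L (jetDeriv k g 0 X) = normalClass k L (jetDeriv k g 0 Y) ↔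
      SymSum.regrade 2 (k + 1) 3 (k + 1) X = SymSum.regrade 2 (k + 1) 3 (k + 1) Y := by
  have hD : ∀ Q, jetDeriv k g 0 (SymSum.regrade 2 2 2 (k + 1) Q) + jetDeriv k g 0 Y =
      jetDeriv k g 0 X ↔ SymSum.regrade 2 2 2 (k + 1) Q + Y = X := fun Q => by
    rw [← map_add, (jetDeriv_bijective k g 0).1.eq_iff]
  have h1 : normalClass k L (jetDeriv k g 0 X) = normalClass k L (jetDeriv k g 0 Y) ↔
      ∃ q, HAdd.hAdd (α := SymSum 2 (k + 1) W) (β := SymSum 2 (k + 1) W)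
        (mfderiv 𝓘(ℂ, SymSum 2 2 W) 𝓘(ℂ, SymSum 2 (k + 1) W) (toJet k) L q) (jetDeriv k g 0 Y) =
          jetDeriv k g 0 X :=
    quotient_mk_eq_iff _ _ _
  rw [h1]
  constructor
  · rintro ⟨q, hq⟩
    obtain ⟨Q, hQ⟩ := (mem_range_mfderiv_toJet hk hg _).1 ⟨q, rfl⟩
    rw [← (hD Q).1 (by rw [hQ]; exact hq), map_add,
      SymSum.regrade_eq_zero (disjoint_Icc_two_three k), zero_add]
  · intro h
    obtain ⟨Q, hQ⟩ := exists_quadratic_add_eq hk h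
    obtain ⟨q, hq⟩ := (mem_range_mfderiv_toJet hk hg _).2 ⟨Q, rfl⟩
    exact ⟨q, (congrArg (· + jetDeriv k g 0 Y) hq).trans ((hD Q).2 hQ)⟩

/-- The normal vector at `L` given by a polynomial `F` on `L` and a splitting `g` of `V`: the class
of the velocity of the graph of `t dF`. -/
def normalVector (k : ℕ) (g : Sp W) (L : LagGrass W) (hg : ∀ w : W, g.1 (w, 0) ∈ L.1)
    (F : SymSum 3 (k + 1) L.1) : NormalSpace k L :=
  normalClass k L (jetDeriv k g 0
    (SymSum.regrade 3 (k + 1) 2 (k + 1) (F.pullback (frameMap g L hg))))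

theorem normalVector_frame_independent (k : ℕ) {g g' : Sp W} {L : LagGrass W}
    (hg : ∀ w : W, g.1 (w, 0) ∈ L.1) (hg' : ∀ w : W, g'.1 (w, 0) ∈ L.1)
    (F : SymSum 3 (k + 1) L.1) : normalVector k g' L hg' F = normalVector k g L hg F := by
  rw [normalVector, normalVector, SymSum.regrade_pullback, SymSum.regrade_pullback,
    jetDeriv_frame_independent k hg hg']

theorem normalVector_bijective {k : ℕ} (hk : 1 ≤ k) {g : Sp W} {L : LagGrass W}
    (hg : ∀ w : W, g.1 (w, 0) ∈ L.1) : Function.Bijective (normalVector k g L hg) := by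
  have hinv : ∀ G : SymSum 3 (k + 1) W, (SymSum.pullback (M := L.1)
      ((frameEquiv g L hg).symm : L.1 →L[ℂ] W) G).pullback (frameMap g L hg) = G := fun G => by
    rw [SymSum.pullback_pullback]
    conv_rhs => rw [← SymSum.pullback_id G]
    congr 1
    ext1 w
    exact (frameEquiv g L hg).symm_apply_apply w
  have hinv' : ∀ F : SymSum 3 (k + 1) L.1, (F.pullback (frameMap g L hg)).pullback
      ((frameEquiv g L hg).symm : L.1 →L[ℂ] W) = F := fun F => by
    rw [SymSum.pullback_pullback]
    conv_rhs => rw [← SymSum.pullback_id F]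
    congr 1
    ext1 w
    exact (frameEquiv g L hg).apply_symm_apply w
  constructor
  · intro F G h
    have h1 := (normalClass_eq_iff hk hg _ _).1 h
    rw [SymSum.regrade_regrade (Icc_three_subset k), SymSum.regrade_regrade (Icc_three_subset k)]
      at h1
    rw [← hinv' F, h1, hinv' G]
  · intro s
    obtain ⟨v, rfl⟩ := Submodule.Quotient.mk_surjective _ s
    obtain ⟨X, rfl⟩ := (jetDeriv_bijective k g 0).2 v
    refine ⟨SymSum.pullback (M := L.1) ((frameEquiv g L hg).symm : L.1 →L[ℂ] W)
      (SymSum.regrade 2 (k + 1) 3 (k + 1) X), (normalClass_eq_iff hk hg _ _).2 ?_⟩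
    rw [hinv, SymSum.regrade_regrade (Icc_three_subset k)]

/-- The isomorphism `N_G 𝓛 ≅ ⨁ Sym^i(R*)` at `L`: the inverse of the map which sends a polynomial
to its normal vector. -/
def normalIso {k : ℕ} (hk : 1 ≤ k) (L : LagGrass W) :
    NormalSpace k L ≃ₗ[ℂ] SymSum 3 (k + 1) L.1 :=
  (LinearEquiv.ofBijective
    (M := SymSum 3 (k + 1) L.1) (M₂ := NormalSpace k L)
    { toFun := normalVector k L.exists_frame.choose L L.exists_frame.choose_spec
      map_add' := fun F G => by
        change normalClass k L (jetDeriv k _ 0 (SymSum.regrade _ _ _ _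
          (SymSum.pullbackL _ _ _ (F + G)))) = _
        rw [map_add, map_add, map_add]
        rfl
      map_smul' := fun c F => by
        change normalClass k L (jetDeriv k _ 0 (SymSum.regrade _ _ _ _
          (SymSum.pullbackL _ _ _ (c • F)))) = _
        rw [map_smul, map_smul, map_smul]
        rfl }
    (normalVector_bijective hk L.exists_frame.choose_spec)).symm

theorem normalIso_normalVector {k : ℕ} (hk : 1 ≤ k) {g : Sp W} {L : LagGrass W}
    (hg : ∀ w : W, g.1 (w, 0) ∈ L.1) (F : SymSum 3 (k + 1) L.1) :
    normalIso hk L (normalVector k g L hg F) = F := by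
  rw [normalVector_frame_independent k L.exists_frame.choose_spec hg]
  exact (LinearEquiv.symm_apply_eq _).2 rfl

theorem normalVector_normalIso {k : ℕ} (hk : 1 ≤ k) {g : Sp W} {L : LagGrass W}
    (hg : ∀ w : W, g.1 (w, 0) ∈ L.1) (s : NormalSpace k L) :
    normalVector k g L hg (normalIso hk L s) = s :=
  (normalIso hk L).injective (normalIso_normalVector hk hg _)

theorem fibreParam_eq_jetParam (k : ℕ) {g : Sp W} {L : LagGrass W}
    (hg : ∀ w : W, g.1 (w, 0) ∈ L.1) (F : SymSum 3 (k + 1) L.1) : fibreParam k g L hg F =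
      jetParam k g (SymSum.regrade 3 (k + 1) 2 (k + 1) (F.pullback (frameMap g L hg))) := by
  refine jet_eq_of_linear_reparam k (ContinuousLinearEquiv.refl ℂ W) fun x => ?_
  rw [ContinuousLinearEquiv.refl_apply, graphGerm_apply, graphGerm_apply,
    SymSum.eval_regrade (Icc_three_subset k)]

theorem fibreParam_zero (k : ℕ) {g : Sp W} {L : LagGrass W} (hg : ∀ w : W, g.1 (w, 0) ∈ L.1) :
    fibreParam k g L hg 0 = toJet k L := by
  rw [fibreParam_eq_jetParam, toJet_eq_jetParam_zero k hg]
  change jetParam k g (SymSum.regrade 3 (k + 1) 2 (k + 1) 0) = _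
  rw [map_zero]

theorem tangentMap_of_eq_jetParam (k : ℕ) {N : Type*} [NormedAddCommGroup N] [NormedSpace ℂ N]
    [FiniteDimensional ℂ N] (g : Sp W) (A : W →L[ℂ] N) (f : SymSum 3 (k + 1) N → JetSpace k W)
    {y : JetSpace k W}
    (hf : ∀ F, f F = jetParam k g (SymSum.regrade 3 (k + 1) 2 (k + 1) (F.pullback A)))
    (hy : f 0 = y) (F : SymSum 3 (k + 1) N) :
    tangentMap 𝓘(ℂ, SymSum 3 (k + 1) N) 𝓘(ℂ, SymSum 2 (k + 1) W) f ⟨0, F⟩ =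
      (⟨y, jetDeriv k g 0 (SymSum.regrade 3 (k + 1) 2 (k + 1) (F.pullback A))⟩ :
        TangentBundle 𝓘(ℂ, SymSum 2 (k + 1) W) (JetSpace k W)) :=
  tangentMap_of_eq_comp_linear (E₁ := SymSum 3 (k + 1) N) (E := SymSum 2 (k + 1) W)
    ⟨fun x y => map_add (SymSum.regrade 3 (k + 1) 2 (k + 1)) (x.pullback A) (y.pullback A),
      fun c x => map_smul (SymSum.regrade 3 (k + 1) 2 (k + 1)) c (x.pullback A)⟩
    (mdifferentiableAt_jetParam k g 0) hf hy F

set_option maxHeartbeats 1000000 in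
/-- The tangent vector of `𝓛(V)` at `L` given by a polynomial on `L` is the derivative of the
parametrization `fibreParam`. -/
theorem tangentMap_fibreParam (k : ℕ) {g : Sp W} {L : LagGrass W}
    (hg : ∀ w : W, g.1 (w, 0) ∈ L.1) (F : SymSum 3 (k + 1) L.1) :
    tangentMap 𝓘(ℂ, SymSum 3 (k + 1) L.1) 𝓘(ℂ, SymSum 2 (k + 1) W) (fibreParam k g L hg) ⟨0, F⟩ =
      (⟨toJet k L, jetDeriv k g 0
        (SymSum.regrade 3 (k + 1) 2 (k + 1) (F.pullback (frameMap g L hg)))⟩ :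
          TangentBundle 𝓘(ℂ, SymSum 2 (k + 1) W) (JetSpace k W)) := by
  have h := tangentMap_of_eq_jetParam (N := L.1) k g (frameMap g L hg) (fibreParam k g L hg)
    (y := toJet k L) ?_ ?_ F
  · exact h
  · intro F
    with_reducible exact fibreParam_eq_jetParam k hg F
  · exact fibreParam_zero k hg

end TangentSpaces

/-! ### Coordinates of sections of the bundles of symmetric forms -/

section VectorValuedMaps

variable {E E₁ N : Type*} [NormedAddCommGroup E] [NormedSpace ℂ E] [NormedAddCommGroup E₁]
  [NormedSpace ℂ E₁] [TopologicalSpace N] [ChartedSpace E₁ N]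

theorem contMDiffAt_linear_comp [FiniteDimensional ℂ E] {E' : Type*} [NormedAddCommGroup E']
    [NormedSpace ℂ E'] {T : E → E'} (hT : IsLinearMap ℂ T) {f : N → E} {y₀ : N}
    (hf : ContMDiffAt 𝓘(ℂ, E₁) 𝓘(ℂ, E) ω f y₀) :
    ContMDiffAt 𝓘(ℂ, E₁) 𝓘(ℂ, E') ω (fun y => T (f y)) y₀ :=
  (LinearMap.toContinuousLinearMap (hT.mk' T)).contMDiff.contMDiffAt.comp y₀ hf

/-- A map to a finite-dimensional space is holomorphic if its compositions with sufficiently many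
linear forms are. -/
theorem contMDiffAt_of_separating [FiniteDimensional ℂ E] {α : Type*} (φ : α → E → ℂ)
    (hφ : ∀ a, IsLinearMap ℂ (φ a)) (hsep : ∀ x, (∀ a, φ a x = 0) → x = 0) {f : N → E} {y₀ : N}
    (hf : ∀ a, ContMDiffAt 𝓘(ℂ, E₁) 𝓘(ℂ, ℂ) ω (fun y => φ a (f y)) y₀) :
    ContMDiffAt 𝓘(ℂ, E₁) 𝓘(ℂ, E) ω f y₀ := by
  -- the linear forms whose composition with `f` is holomorphic
  let S : Submodule ℂ (Module.Dual ℂ E) :=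
    { carrier := {ψ | ContMDiffAt 𝓘(ℂ, E₁) 𝓘(ℂ, ℂ) ω (fun y => ψ (f y)) y₀}
      zero_mem' := contMDiffAt_const
      add_mem' := fun h h' => h.add h'
      smul_mem' := fun c ψ h => contMDiffAt_linear_comp (E := ℂ) (T := fun z => c * z)
        ⟨mul_add c, fun d z => mul_left_comm c d z⟩ h }
  have hbot : S.dualCoannihilator = ⊥ := by
    refine (Submodule.eq_bot_iff _).2 fun x hx => hsep x fun a => ?_
    exact (Submodule.mem_dualCoannihilator x).1 hx ((hφ a).mk' (φ a)) (hf a)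
  have htop : S = ⊤ := by
    rw [← Subspace.dualCoannihilator_dualAnnihilator_eq (W := S), hbot,
      Submodule.dualAnnihilator_bot]
  let b := Module.finBasis ℂ E
  have h1 : ContMDiffAt 𝓘(ℂ, E₁) 𝓘(ℂ, Fin (Module.finrank ℂ E) → ℂ) ω
      (fun y => b.equivFun (f y)) y₀ := by
    refine contMDiffAt_pi_space.2 fun i => ?_
    have h2 : b.coord i ∈ S := htop ▸ Submodule.mem_top
    exact h2
  have h3 := contMDiffAt_linear_comp (T := b.equivFun.symm)
    ⟨map_add b.equivFun.symm, map_smul b.equivFun.symm⟩ h1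
  simpa using h3

/-- Tangent vectors at `x` are recovered from their coordinates in a chart. The equation `x = e.symm a`
is a hypothesis since the tangent spaces at its two sides are the model space by definition, although
they are not syntactically equal. -/
theorem mfderiv_symm_mfderiv {M : Type*} [TopologicalSpace M] [ChartedSpace E M]
    [IsManifold 𝓘(ℂ, E) ω M] {e : OpenPartialHomeomorph M E} (he : e ∈ atlas E M) {x : M} {a : E}
    (ha : a ∈ e.target) (hx : x = e.symm a) (v : E) :
    (mfderiv 𝓘(ℂ, E) 𝓘(ℂ, E) e.symm a (mfderiv 𝓘(ℂ, E) 𝓘(ℂ, E) e x v : E) : E) = v := by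
  have h1 : a = e x := by rw [hx, e.right_inv ha]
  have h2 : x ∈ e.source := by rw [hx]; exact e.map_target ha
  subst h1
  exact congrArg (fun T : E →L[ℂ] E => T v) ((mdifferentiable_of_mem_atlas he).symm_comp_deriv h2)

theorem contDiff_symForm_apply {W : Type*} [NormedAddCommGroup W] [NormedSpace ℂ W] {a b : ℕ}
    (i : Finset.Icc a b) :
    ContDiff ℂ ω (fun q : SymSum a b W × (Fin (i : ℕ) → W) => (q.1 i).1 q.2) := by
  let P : SymSum a b W →L[ℂ] ContinuousMultilinearMap ℂ (fun _ : Fin (i : ℕ) => W) ℂ :=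
    (SymForm (i : ℕ) W).subtypeL ∘L ContinuousLinearMap.proj i
  refine contDiff_iff_contDiffAt.2 fun q => ?_
  have := ContinuousLinearMap.analyticAt_uncurry_of_multilinear (𝕜 := ℂ) (F := ℂ)
    (Em := fun _ : Fin (i : ℕ) => W) P (x := q)
  exact this.contDiffAt

end VectorValuedMaps

section Coordinates

variable {W : Type*} [NormedAddCommGroup W] [NormedSpace ℂ W] [FiniteDimensional ℂ W]

/-- The frame of the Lagrangian subspaces `L` in the domain of the chart given by `g` which depends
holomorphically on `L`: the shear of `g` by the coordinates of `L`. -/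
def chartFrame (g : Sp W) (L : LagGrass W) : Sp W := g * shear (grassChart g L)

theorem grassParam_grassChart {g : Sp W} {L : LagGrass W} (hL : L ∈ (grassChart g).source) :
    grassParam g (grassChart g L) = L := (grassChart g).left_inv hL

theorem chartFrame_mem {g : Sp W} {L : LagGrass W} (hL : L ∈ (grassChart g).source) (w : W) :
    (chartFrame g L).1 (w, 0) ∈ L.1 := by
  have h := shear_frame g (grassChart g L) w
  rwa [grassParam_grassChart hL] at h

theorem chartFrame_apply (g : Sp W) (L : LagGrass W) (w : W) :
    (chartFrame g L).1 (w, 0) = g.1 (w, fderiv ℂ (grassChart g L).eval w) := by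
  rw [chartFrame, mul_apply, shear_apply, zero_add]

theorem contMDiffAt_grassChart {g : Sp W} {L₀ : LagGrass W} (hL₀ : L₀ ∈ (grassChart g).source) :
    ContMDiffAt 𝓘(ℂ, SymSum 2 2 W) 𝓘(ℂ, SymSum 2 2 W) ω (grassChart g) L₀ :=
  (contMDiffOn_of_mem_maximalAtlas (I := 𝓘(ℂ, SymSum 2 2 W)) (n := ω)
    (IsManifold.subset_maximalAtlas (grassChart_mem_atlas g))).contMDiffAt
      ((grassChart g).open_source.mem_nhds hL₀)

theorem contMDiffAt_chartFrame {g : Sp W} {L₀ : LagGrass W} (hL₀ : L₀ ∈ (grassChart g).source)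
    (w : W) : ContMDiffAt 𝓘(ℂ, SymSum 2 2 W) 𝓘(ℂ, SympSpace W) ω
      (fun L => (chartFrame g L).1 (w, 0)) L₀ := by
  simp only [chartFrame_apply]
  have h : ContDiff ℂ ω (fun Q : SymSum 2 2 W => g.1 (w, fderiv ℂ Q.eval w)) :=
    g.1.contDiff.comp (contDiff_graph.comp (contDiff_id.prodMk contDiff_const))
  exact h.contMDiff.contMDiffAt.comp L₀ (contMDiffAt_grassChart hL₀)

open Classical in
/-- The coordinates of a section of `⨁ Sym^i(R*)` in the trivialization given by `chartFrame g`,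
with the value `0` outside the domain of the chart. -/
def symCoord {a b : ℕ} (g : Sp W) (P : (L : LagGrass W) → SymSum a b L.1) (L : LagGrass W) :
    SymSum a b W :=
  if hL : L ∈ (grassChart g).source then
    (P L).pullback (frameMap (chartFrame g L) L (chartFrame_mem hL)) else 0

theorem symCoord_of_mem {a b : ℕ} {g : Sp W} (P : (L : LagGrass W) → SymSum a b L.1)
    {L : LagGrass W} (hL : L ∈ (grassChart g).source) : symCoord g P L =
      (P L).pullback (frameMap (chartFrame g L) L (chartFrame_mem hL)) := dif_pos hL

/-- A section of `⨁ Sym^i(R*)` is holomorphic if and only if its coordinates are. -/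
theorem symHolomorphicAt_iff {a b : ℕ} {g : Sp W} (P : (L : LagGrass W) → SymSum a b L.1)
    {L₀ : LagGrass W} (hL₀ : L₀ ∈ (grassChart g).source) : SymHolomorphicAt P L₀ ↔
      ContMDiffAt 𝓘(ℂ, SymSum 2 2 W) 𝓘(ℂ, SymSum a b W) ω (symCoord g P) L₀ := by
  have hnhds : ∀ᶠ L in 𝓝 L₀, L ∈ (grassChart g).source :=
    (grassChart g).open_source.mem_nhds hL₀
  constructor
  · intro h
    classical
    -- the values of the coordinates on constant vectors are the values on the sections of the frame
    let r : W → (L : LagGrass W) → L.1 := fun w L =>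
      if hL : L ∈ (grassChart g).source then frameMap (chartFrame g L) L (chartFrame_mem hL) w
      else 0
    have hr : ∀ w L (hL : L ∈ (grassChart g).source),
        r w L = frameMap (chartFrame g L) L (chartFrame_mem hL) w := fun w L hL => dif_pos hL
    have hrh : ∀ w, TautHolomorphicAt (r w) L₀ := fun w => by
      refine (contMDiffAt_chartFrame hL₀ w).congr_of_eventuallyEq ?_
      filter_upwards [hnhds] with L hL
      rw [hr w L hL, coe_frameMap]
    refine contMDiffAt_of_separating (E := SymSum a b W) (E₁ := SymSum 2 2 W)
      (α := Σ i : Finset.Icc a b, Fin (i : ℕ) → W)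
      (fun q F => (F q.1).1 q.2) (fun q => ⟨fun _ _ => rfl, fun _ _ => rfl⟩) (fun F hF => ?_)
      (fun q => ?_)
    · funext i
      ext v
      exact hF ⟨i, v⟩
    · refine (h q.1 (fun j => r (q.2 j)) fun j => hrh _).congr_of_eventuallyEq ?_
      filter_upwards [hnhds] with L hL
      simp only [hr _ L hL]
      rw [symCoord_of_mem P hL]
      rfl
  -- conversely, the coordinates `W ≅ L` are inverse to the restriction to `L` of the fixed map `g⁻¹`
  -- followed by the projection to `W`, because shears preserve the first component
  · intro h i r hr
    have h1 : ContMDiffAt 𝓘(ℂ, SymSum 2 2 W) 𝓘(ℂ, Fin (i : ℕ) → W) ω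
        (fun L j => (g.1.symm (r j L : SympSpace W)).1) L₀ := by
      refine contMDiffAt_pi_space.2 fun j => ?_
      have h2 : ContDiff ℂ ω (fun v : SympSpace W => (g.1.symm v).1) :=
        contDiff_fst.comp g.1.symm.contDiff
      exact h2.contMDiff.contMDiffAt.comp L₀ (hr j)
    have h3 := (contDiff_symForm_apply (W := W) i).contMDiff.contMDiffAt.comp L₀
      (h.prodMk_space h1)
    refine h3.congr_of_eventuallyEq ?_
    filter_upwards [hnhds] with L hL
    change _ = (symCoord g P L i).1 (fun j => (g.1.symm (r j L : SympSpace W)).1)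
    rw [symCoord_of_mem P hL]
    refine congrArg (P L i).1 (funext fun j => Subtype.ext ?_)
    exact (apply_symm_fst (chartFrame_mem hL) (r j L).2).symm

end Coordinates

/-! ### Holomorphic sections of the normal bundle -/

section NormalBundle

variable {W : Type*} [NormedAddCommGroup W] [NormedSpace ℂ W] [FiniteDimensional ℂ W]

theorem toJet_eq_jetParam {k : ℕ} (hk : 1 ≤ k) {g : Sp W} {L : LagGrass W}
    (hL : L ∈ (grassChart g).source) :
    toJet k L = jetParam k g (SymSum.regrade 2 2 2 (k + 1) (grassChart g L)) := by
  rw [← toJet_grassParam hk, grassParam_grassChart hL]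

/-- A normal vector in terms of its coordinates. -/
theorem eq_normalClass_symCoord {k : ℕ} (hk : 1 ≤ k) {g : Sp W}
    (s : (L : LagGrass W) → NormalSpace k L) {L : LagGrass W} (hL : L ∈ (grassChart g).source) :
    s L = normalClass k L (jetDeriv k (chartFrame g L) 0 (SymSum.regrade 3 (k + 1) 2 (k + 1)
      (symCoord g (fun L => normalIso hk L (s L)) L))) := by
  rw [symCoord_of_mem _ hL]
  exact (normalVector_normalIso hk (chartFrame_mem hL) (s L)).symm

/-- The coordinates of a normal vector are the terms of degree at least `3` of the coordinates of any
tangent vector which represents it, in the chart of the fixed `g`. -/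
theorem symCoord_eq_of_normalClass_eq {k : ℕ} (hk : 1 ≤ k) {g : Sp W}
    (s : (L : LagGrass W) → NormalSpace k L) {L : LagGrass W} (hL : L ∈ (grassChart g).source)
    {X t : SymSum 2 (k + 1) W}
    (hX : jetDeriv k g (SymSum.regrade 2 2 2 (k + 1) (grassChart g L)) X = t)
    (ht : normalClass k L t = s L) : symCoord g (fun L => normalIso hk L (s L)) L =
      SymSum.regrade 2 (k + 1) 3 (k + 1) X := by
  rw [← jetDeriv_mul_shear hk] at hX
  rw [← hX, eq_normalClass_symCoord hk s hL] at ht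
  have h := (normalClass_eq_iff hk (chartFrame_mem hL) _ _).1 ht
  rw [SymSum.regrade_regrade (Icc_three_subset k)] at h
  exact h.symm

theorem eq_normalIso {k : ℕ} (hk : 1 ≤ k) {g : Sp W} {L : LagGrass W}
    (hg : ∀ w : W, g.1 (w, 0) ∈ L.1) (Ψ : NormalSpace k L ≃ₗ[ℂ] SymSum 3 (k + 1) L.1)
    (h : ∀ F, Ψ (normalVector k g L hg F) = F) : Ψ = normalIso hk L := by
  refine LinearEquiv.ext fun s => ?_
  have h1 := h (normalIso hk L s)
  rwa [normalVector_normalIso] at h1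

set_option maxHeartbeats 1600000 in
/-- A section of the normal bundle is holomorphic if and only if its coordinates are. -/
theorem normalHolomorphicAt_iff {k : ℕ} (hk : 1 ≤ k) {g : Sp W}
    (s : (L : LagGrass W) → NormalSpace k L) {L₀ : LagGrass W} (hL₀ : L₀ ∈ (grassChart g).source) :
    NormalHolomorphicAt k s L₀ ↔
      ContMDiffAt 𝓘(ℂ, SymSum 2 2 W) 𝓘(ℂ, SymSum 3 (k + 1) W) ω
        (symCoord g fun L => normalIso hk L (s L)) L₀ := by
  have hnhds : ∀ᶠ L in 𝓝 L₀, L ∈ (grassChart g).source :=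
    (grassChart g).open_source.mem_nhds hL₀
  constructor
  · rintro ⟨t, ht, hts⟩
    have h1 := contMDiffAt_mfderiv_chart (E := SymSum 2 (k + 1) W) (E' := SymSum 2 2 W)
      (jetChart_mem_atlas k g) ⟨_, (toJet_eq_jetParam hk hL₀).symm⟩ ht
    refine (contMDiffAt_linear_comp (E := SymSum 2 (k + 1) W) (E' := SymSum 3 (k + 1) W)
      (T := SymSum.regrade 2 (k + 1) 3 (k + 1))
      ⟨map_add (SymSum.regrade 2 (k + 1) 3 (k + 1)),
        map_smul (SymSum.regrade 2 (k + 1) 3 (k + 1))⟩ h1).congr_of_eventuallyEq ?_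
    filter_upwards [hnhds, hts] with L hL hs
    exact symCoord_eq_of_normalClass_eq hk s hL (mfderiv_symm_mfderiv (E := SymSum 2 (k + 1) W)
      (jetChart_mem_atlas k g) trivial (toJet_eq_jetParam hk hL) (t L)) hs
  · intro h
    refine ⟨fun L => jetDeriv k g (SymSum.regrade 2 2 2 (k + 1) (grassChart g L))
      (SymSum.regrade 3 (k + 1) 2 (k + 1) (symCoord g (fun L => normalIso hk L (s L)) L)), ?_, ?_⟩
    · have h1 := contMDiffAt_mfderiv_symm_chart (E := SymSum 2 (k + 1) W) (E' := SymSum 2 2 W)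
        (jetChart_mem_atlas k g) rfl
        (contMDiffAt_linear_comp (E := SymSum 2 2 W) (E' := SymSum 2 (k + 1) W)
          (T := SymSum.regrade 2 2 2 (k + 1))
          ⟨map_add (SymSum.regrade 2 2 2 (k + 1)), map_smul (SymSum.regrade 2 2 2 (k + 1))⟩
          (contMDiffAt_grassChart hL₀))
        (contMDiffAt_linear_comp (E := SymSum 3 (k + 1) W) (E' := SymSum 2 (k + 1) W)
          (T := SymSum.regrade 3 (k + 1) 2 (k + 1))
          ⟨map_add (SymSum.regrade 3 (k + 1) 2 (k + 1)),
            map_smul (SymSum.regrade 3 (k + 1) 2 (k + 1))⟩ h)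
      refine h1.congr_of_eventuallyEq ?_
      filter_upwards [hnhds] with L hL
      exact tangentBundle_mk_congr (E := SymSum 2 (k + 1) W) (toJet_eq_jetParam hk hL) _
    · filter_upwards [hnhds] with L hL
      rw [eq_normalClass_symCoord hk s hL, chartFrame, jetDeriv_mul_shear hk]

end NormalBundle

end

end LagrangianJets

open LagrangianJets
set_option maxHeartbeats 1600000 in
theorem lemma4p5 {W : Type*} [NormedAddCommGroup W] [NormedSpace ℂ W] [FiniteDimensional ℂ W]
    (k : ℕ) (hk : 1 ≤ k) :
    Manifold.IsSmoothEmbedding 𝓘(ℂ, SymSum 2 2 W) 𝓘(ℂ, SymSum 2 (k + 1) W) ω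
      (toJet k : LagGrass W → JetSpace k W) ∧
    ∃! Φ : (L : LagGrass W) → (NormalSpace k L ≃ₗ[ℂ] SymSum 3 (k + 1) L.1),
      (∀ (s : (L : LagGrass W) → NormalSpace k L) (L₀ : LagGrass W),
        NormalHolomorphicAt k s L₀ ↔ SymHolomorphicAt (fun L => Φ L (s L)) L₀) ∧
      (∀ (L : LagGrass W) (g : Sp W) (hg : ∀ w : W, g.1 (w, 0) ∈ L.1) (F : SymSum 3 (k + 1) L.1),
        ∃ v : TangentSpace 𝓘(ℂ, SymSum 2 (k + 1) W) (toJet k L),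
          (⟨toJet k L, v⟩ : TangentBundle 𝓘(ℂ, SymSum 2 (k + 1) W) (JetSpace k W)) =
            tangentMap 𝓘(ℂ, SymSum 3 (k + 1) L.1) 𝓘(ℂ, SymSum 2 (k + 1) W)
              (fibreParam k g L hg) ⟨0, F⟩ ∧
          Φ L (normalClass k L v) = F) := by
  refine ⟨isSmoothEmbedding_toJet hk, normalIso hk, ⟨fun s L₀ => ?_, fun L g hg F =>
    ⟨_, (tangentMap_fibreParam k hg F).symm, normalIso_normalVector hk hg F⟩⟩, ?_⟩
  · obtain ⟨g, hg⟩ := L₀.exists_frame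
    have hL₀ : L₀ ∈ (grassChart g).source := ⟨0, grassParam_zero hg⟩
    exact (normalHolomorphicAt_iff hk s hL₀).trans
      (symHolomorphicAt_iff _ hL₀).symm
  · rintro Φ ⟨-, hΦ⟩
    funext L
    obtain ⟨g, hg⟩ := L.exists_frame
    refine eq_normalIso hk hg (Φ L) fun F => ?_
    obtain ⟨v, hv, hF⟩ := hΦ L g hg F
    have h1 : normalClass k L v = normalVector k g L hg F := congrArg (normalClass k L)
      (eq_of_heq (Bundle.TotalSpace.mk.inj (hv.trans (tangentMap_fibreParam k hg F))).2)
    exact (congrArg (Φ L) h1).symm.trans hF
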